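/- Let $k\ge 2$ be an integer. Let $(T_n)_{n\ge 0}$ be the following growing sequence of random rooted $k$-ary trees. The tree $T_0$ has one edge and two vertices, the root $\rho$ and one leaf. Given $T_0,\dots,T_n$, choose one edge of $T_n$ uniformly at random, split it into two edges by a new vertex, and attach $k-1$ new edges, each ending in a new leaf, to this new vertex; this gives $T_{n+1}$. So $T_n$ has $(k-1)n+1$ leaves. Number the leaves $L_n^1,L_n^2,\dots$ by order of apparition: the leaves of $T_n$ keep their number in $T_{n+1}$, and the $k-1$ new leaves of $T_{n+1}$ are $L_{n+1}^{(k-1)n+2},\dots,L_{n+1}^{(k-1)n+k}$. View $T_n$ as a rooted $\mathbb R$-tree whose edges are segments of length $1$, with metric $d$, and for $n\ge p$ let $T_n^p\subset T_n$ be the subtree spanned by the root and the leaves $L_n^i$, $i\le (k-1)p+1$. Then there are random variables $H^i, L^i$ ($i\ge 1$) with values in the space $\ell^1$ of summable real sequences $(e_i$ denotes its $i$-th unit vector$)$ such that, with $$\mathcal T^p=\bigcup_{i=1}^{(k-1)p+1}[H^i,L^i]\subset \ell^1\qquad(p\ge 0),$$ the following holds almost surely. 1. (Stick-breaking.) $H^1=0$;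 for every $i\ge 2$ the point $H^i$ belongs to $\bigcup_{j<i}[H^j,L^j]$; and for every $i\ge 1$, $L^i=H^i+a_i e_i$ for some $a_i>0$. 2. For every $p\ge 0$, $\mathcal T^p$ with the metric of $\ell^1$, rooted at $0$, is a compact $\mathbb R$-tree; it has exactly $(k-1)p+1$ leaves (points of degree one other than the root), namely the points $L^i$, $i\le (k-1)p+1$. 3. For every $p\ge 0$, as $n\to\infty$, $$\frac{T_n^p}{n^{1/k}}\longrightarrow \mathcal T^p$$ for the Gromov–Hausdorff distance between rooted compact metric spaces. Moreover the points $L^i$ are the limits of the leaves $L^i_n$, in the sense that $n^{-1/k}d(\rho,L_n^i)\to\|L^i\|_{\ell^1}$ and $n^{-1/k}d(L_n^i,L_n^j)\to\|L^i-L^j\|_{\ell^1}$ for all $i,j\ge 1$. 4. For all $0\le p'<p$, $\mathcal T^{p'}$ is the subtree of $\mathcal T^p$ spanned by the root and the leaves $L^i$, $i\le (k-1)p'+1$. -/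

import Mathlib

open Set Filter Topology MeasureTheory
open scoped ENNReal Pointwise

/-! ### Real trees -/

/-- `X` is an `ℝ`-tree: any two points are joined by a geodesic path, and the image of that geodesic
is the image of every continuous self-avoiding path between the two points. -/
def IsRTree (X : Type*) [MetricSpace X] : Prop :=
  ∀ x y : X, ∃ γ : ℝ → X,
    γ 0 = x ∧ γ (dist x y) = y ∧
    (∀ s ∈ Icc (0 : ℝ) (dist x y), ∀ t ∈ Icc (0 : ℝ) (dist x y), dist (γ s) (γ t) = |s - t|) ∧
    ∀ f : ℝ → X, ContinuousOn f (Icc 0 1) → InjOn f (Icc 0 1) → f 0 = x → f 1 = y →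
      f '' Icc 0 1 = γ '' Icc 0 (dist x y)

/-- The leaves of a tree `A` rooted at `ρ` (a subset of a metric space): the points `x ≠ ρ` of
degree one, where the degree of `x` is the number of connected components of `A \ {x}`. -/
def treeLeaves {M : Type*} [MetricSpace M] (A : Set M) (ρ : M) : Set M :=
  {x ∈ A | x ≠ ρ ∧ Nat.card (ConnectedComponents ↥(A \ {x})) = 1}

/-- The subtree of the tree `A` spanned by the set of points `S ⊆ A`: the union of the geodesics
`[[x, y]] = {z ∈ A | d(x, z) + d(z, y) = d(x, y)}` of `A` with `x, y ∈ S`. -/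
def treeSpan {M : Type*} [MetricSpace M] (A S : Set M) : Set M :=
  {z ∈ A | ∃ x ∈ S, ∃ y ∈ S, dist x z + dist z y = dist x y}

/-- The Gromov–Hausdorff distance between the rooted metric spaces `(A, a)` and `(B, b)`, where
`a ∈ A` and `b ∈ B`: the infimum, over all metric spaces `Z` and all isometric embeddings `φ` of `A`
and `ψ` of `B` into `Z`, of the maximum of the Hausdorff distance between the images and of the
distance between the images of the roots. -/
noncomputable def rootedGHDist {M N : Type} [MetricSpace M] [MetricSpace N]
    (A : Set M) (a : M) (B : Set N) (b : N) : ℝ≥0∞ :=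
  ⨅ (Z : Type) (_ : MetricSpace Z) (φ : M → Z) (ψ : N → Z)
    (_ : ∀ x ∈ A, ∀ y ∈ A, dist (φ x) (φ y) = dist x y)
    (_ : ∀ x ∈ B, ∀ y ∈ B, dist (ψ x) (ψ y) = dist x y),
    max (Metric.hausdorffEDist (φ '' A) (ψ '' B)) (edist (φ a) (ψ b))

/-! ### The growing sequence of `k`-ary trees -/

/-- Names for the vertices: the root, the internal nodes and the leaves, in order of apparition
(both numbered from `0`, so that `leaf i` is the `(i + 1)`-st leaf). -/
inductive TreeVertex : Type
  | root : TreeVertex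
  | node : ℕ → TreeVertex
  | leaf : ℕ → TreeVertex

namespace TreeVertex

/-- One growth step, from `T_n` to `T_{n+1}`: the edge `e` of `G = T_n` is split into two edges by
the new vertex `node n`, and `k - 1` new edges are grafted on `node n`. Their ends are the new leaves,
numbered from `(k - 1) n + 1` to `(k - 1) n + (k - 1)`. -/
def graft (k n : ℕ) (G : SimpleGraph TreeVertex) (e : Sym2 TreeVertex) :
    SimpleGraph TreeVertex :=
  SimpleGraph.fromEdgeSet
    ((G.edgeSet \ {e}) ∪ {f | ∃ x ∈ e, f = s(x, node n)} ∪
      {f | ∃ j ∈ Ico ((k - 1) * n + 1) ((k - 1) * (n + 1) + 1), f = s(node n, leaf j)})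

/-- The tree `T_n(k)` obtained when `c i` is the edge of `T_i(k)` selected in order to build
`T_{i+1}(k)`. (Names that are not yet in use are isolated vertices of this graph.) -/
def tree (k : ℕ) (c : ℕ → Sym2 TreeVertex) : ℕ → SimpleGraph TreeVertex
  | 0 => SimpleGraph.fromEdgeSet {s(root, leaf 0)}
  | n + 1 => graft k n (tree k c n) (c n)

open Classical in
/-- `ε 0, ε 1, …` are random edges such that, given `ε 0, …, ε (n - 1)`, the edge `ε n` is uniformly
distributed on the edges of the tree `T_n(k)` that these choices have produced. -/
def IsUniformEdgeChoice (k : ℕ) {Ω : Type*} [MeasurableSpace Ω] (μ : Measure Ω)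
    (ε : ℕ → Ω → Sym2 TreeVertex) : Prop :=
  (∀ n e, MeasurableSet {ω | ε n ω = e}) ∧
  ∀ (n : ℕ) (c : ℕ → Sym2 TreeVertex) (e : Sym2 TreeVertex),
    μ {ω | (∀ i < n, ε i ω = c i) ∧ ε n ω = e} =
      if e ∈ (tree k c n).edgeSet then
        μ {ω | ∀ i < n, ε i ω = c i} / ((tree k c n).edgeSet.ncard : ℝ≥0∞)
      else 0

/-! ### Graph-theoretical trees as `ℝ`-trees

A graph-theoretical tree rooted at `root` is viewed as an `ℝ`-tree, with edges that are line segments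
of length `1`, inside `ℓ¹` of its set of vertices: for a vertex `w ≠ root`, the `w`-th coordinate of a
point `x` is the length of the part of `[[root, x]]` that lies on the edge from `w` towards the root.
The `ℓ¹`-distance between two points `x, y` is then the length of the path between them. -/

/-- The space `ℓ¹` over the set of vertices. -/
abbrev EdgeSpace : Type := lp (fun _ : TreeVertex => ℝ) 1

open Classical in
/-- The position of the vertex `v` : the sum of the unit vectors of the vertices `w ≠ root` that are
on the path from the root to `v`. -/
noncomputable def position (G : SimpleGraph TreeVertex) (v : TreeVertex) : EdgeSpace :=
  ∑ᶠ w ∈ {w : TreeVertex | w ≠ root ∧ ∃ q : G.Walk root v, q.IsPath ∧ w ∈ q.support},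
    lp.single 1 w (1 : ℝ)

/-- The `ℝ`-tree of a graph-theoretical tree: every edge is a line segment of length `1`. -/
def realization (G : SimpleGraph TreeVertex) : Set EdgeSpace :=
  {z | ∃ u v, G.Adj u v ∧ z ∈ segment ℝ (position G u) (position G v)}

/-- For the tree `G = T_n(k)`, `marginal k p G` is the subtree `T_n^p` of `T_n` spanned by the root
and the first `(k - 1) p + 1` leaves, with edges of length `1`. -/
def marginal (k p : ℕ) (G : SimpleGraph TreeVertex) : Set EdgeSpace :=
  treeSpan (realization G)
    ({position G root} ∪ {x | ∃ i < (k - 1) * p + 1, x = position G (leaf i)})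

end TreeVertex

/-! ### Stick-breaking in `ℓ¹` -/

/-- The space `ℓ¹` of summable real sequences. -/
abbrev EllOne : Type := lp (fun _ : ℕ => ℝ) 1

/-- The stick-breaking method: the first stick starts at the origin (the root) and follows the first
coordinate up to the first leaf; the `i`-th stick starts at a point `H i` of the union of the former
sticks and follows the `i`-th coordinate, over a positive length, up to the `i`-th leaf `L i`. -/
structure IsStickBreaking (H L : ℕ → EllOne) : Prop where
  start : H 0 = 0
  branch : ∀ i, 1 ≤ i → ∃ j < i, H i ∈ segment ℝ (H j) (L j)
  stick : ∀ i, ∃ a : ℝ, 0 < a ∧ L i = H i + a • lp.single 1 i (1 : ℝ)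

/-- The union of the first `m` sticks. -/
def stickTree (H L : ℕ → EllOne) (m : ℕ) : Set EllOne :=
  {z | ∃ i < m, z ∈ segment ℝ (H i) (L i)}

/-!
Why the rescaled marginals converge.

Call *owner* of a vertex the smallest number of a leaf below it. The vertices with owner `i` form the
`i`-th stick of `T_n`, which runs from a vertex of an earlier stick down to the `i`-th leaf. The
owner of a vertex never changes while the tree grows, and a vertex inserted on an edge has the owner
of the lower end of this edge.

*Folding.* The linear map from `ℓ¹` of the vertices to `ℓ¹(ℕ)` that sends the unit vector of `w` to
the unit vector of its owner is isometric on the realization of `T_n`, since the difference of two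
points of a tree has constant sign on each stick (`Genealogy.Describes.dist_collapse`). The image of
`T_n^p` is the union of the first `(k - 1) p + 1` sticks
(`Genealogy.Describes.image_marginal`), so that all the trees, rescaled, live in the space of the
limit. They are unions of segments, hence their Hausdorff distance is controlled by the ends of
the segments (`rootedGHDist_marginal_le`). The coordinates of these ends are the numbers of vertices
of the `q`-th stick above the `i`-th leaf.

*Convergence of the coordinates.* Such a set of vertices, as well as the part of a stick that is not
above a given leaf, gains the new vertex when an edge above one of its elements is split, and does not
change otherwise. So its size is a Markov chain that goes from `l` to `l + 1` with probability
`l / (k n + 1)`. Divided by its mean growth `∏ (1 + 1 / (k i + 1))`, which is of order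
`n ^ (1 / k)`, it is a nonnegative martingale, which converges. The limit is positive: the function
`1 / √(l - 3 / 4)` of the size, divided by `∏ (1 - 1 / (2 (k i + 1)))`, is a
nonnegative supermartingale, and it dominates a multiple of the inverse square root of the martingale
(`IsSplittingFamily.exists_tendsto`). In the limit, the sticks have positive lengths and no stick
starts at a leaf, because the part of a stick beyond a given leaf keeps a positive length.

*Stick-breaking trees.* A union of sticks in different coordinates is an `ℝ`-tree, since trees can be
glued at a point (`IsRTreeSet.union`, in terms of connected sets in place of self-avoiding paths).
Removing an interior point of a stick disconnects it, and removing the end of a stick does not, if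
no stick starts there (`IsStickBreakingUpTo.treeLeaves_eq`). The first sticks are the points whose
other coordinates vanish, and a point between two points that agree in a coordinate shares this
coordinate (`IsStickBreakingUpTo.stickTree_eq_treeSpan`).
-/

/-! ### Real trees as subsets of a metric space -/

/-- `A` is a subset of a metric space in which any two points `x, y` are joined by a geodesic of `A`
that is contained in every preconnected subset of `A` containing `x` and `y`. Unlike the definition
of `ℝ`-trees by self-avoiding paths, this property is stable under gluing at a point. -/
def IsRTreeSet {M : Type*} [MetricSpace M] (A : Set M) : Prop :=
  ∀ x ∈ A, ∀ y ∈ A, ∃ γ : ℝ → M, γ 0 = x ∧ γ (dist x y) = y ∧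
    (∀ s ∈ Icc (0 : ℝ) (dist x y), γ s ∈ A) ∧
    (∀ s ∈ Icc (0 : ℝ) (dist x y), ∀ t ∈ Icc (0 : ℝ) (dist x y), dist (γ s) (γ t) = |s - t|) ∧
    ∀ C ⊆ A, IsPreconnected C → x ∈ C → y ∈ C → γ '' Icc 0 (dist x y) ⊆ C

/-- If two closed sets share only the point `h`, then a preconnected subset of their union has a
preconnected trace on each of them. -/
theorem IsPreconnected.inter_of_glue {M : Type*} [TopologicalSpace M] {A B C : Set M} {h : M}
    (hA : IsClosed A) (hB : IsClosed B) (hAB : A ∩ B = {h}) (hC : IsPreconnected C)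
    (hCAB : C ⊆ A ∪ B) : IsPreconnected (C ∩ A) := by
  have hhA : h ∈ A := (hAB.ge rfl).1
  have hhB : h ∈ B := (hAB.ge rfl).2
  rw [isPreconnected_closed_iff] at hC ⊢
  intro t t' ht ht' hcov hne hne'
  by_cases hhC : h ∈ C
  · -- the side of the separation that contains `h` absorbs all of `B`
    have key : ∀ t t' : Set M, IsClosed t → IsClosed t' → C ∩ A ⊆ t ∪ t' →
        (C ∩ A ∩ t').Nonempty → h ∈ t → (C ∩ A ∩ (t ∩ t')).Nonempty := by
      intro t t' ht ht' hcov hne' hht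
      obtain ⟨z, hzC, hz1, hz2⟩ := hC ((t ∩ A) ∪ B) (t' ∩ A) ((ht.inter hA).union hB) (ht'.inter hA)
        (fun z hz => by
          rcases hCAB hz with h1 | h1
          · rcases hcov ⟨hz, h1⟩ with h2 | h2
            · exact Or.inl (Or.inl ⟨h2, h1⟩)
            · exact Or.inr ⟨h2, h1⟩
          · exact Or.inl (Or.inr h1))
        ⟨h, hhC, Or.inr hhB⟩ (by obtain ⟨z, hz, hz'⟩ := hne'; exact ⟨z, hz.1, hz', hz.2⟩)
      rcases hz1 with hz1 | hz1
      · exact ⟨z, ⟨hzC, hz2.2⟩, hz1.1, hz2.1⟩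
      · have : z = h := hAB.le ⟨hz2.2, hz1⟩
        subst this
        exact ⟨z, ⟨hzC, hz2.2⟩, hht, hz2.1⟩
    rcases hcov ⟨hhC, hhA⟩ with hh | hh
    · exact key t t' ht ht' hcov hne' hh
    · rw [inter_comm t t']
      exact key t' t ht' ht (by rwa [union_comm]) hne hh
  · have hCA : C ⊆ A := by
      by_contra hcon
      obtain ⟨z, hzC, hzA⟩ := not_subset.1 hcon
      obtain ⟨w, hw, -⟩ := hne
      obtain ⟨u, huC, hu⟩ := hC A B hA hB hCAB ⟨w, hw⟩ ⟨z, hzC, (hCAB hzC).resolve_left hzA⟩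
      rw [hAB] at hu
      exact hhC (hu ▸ huC)
    rw [inter_eq_left.2 hCA] at hcov hne hne' ⊢
    exact hC t t' ht ht' hcov hne hne'

/-- Two tree sets glued at a point form a tree set, if the distance is additive through this
point. -/
theorem IsRTreeSet.union {M : Type*} [MetricSpace M] {A B : Set M} {h : M}
    (tA : IsRTreeSet A) (tB : IsRTreeSet B) (hA : IsClosed A) (hB : IsClosed B)
    (hAB : A ∩ B = {h}) (hd : ∀ x ∈ A, ∀ y ∈ B, dist x y = dist x h + dist h y) :
    IsRTreeSet (A ∪ B) := by
  have hhA : h ∈ A := (hAB.ge rfl).1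
  have hhB : h ∈ B := (hAB.ge rfl).2
  have same : ∀ A B : Set M, IsRTreeSet A → IsClosed A → IsClosed B → A ∩ B = {h} →
      ∀ x ∈ A, ∀ y ∈ A, ∃ γ : ℝ → M, γ 0 = x ∧ γ (dist x y) = y ∧
      (∀ s ∈ Icc (0 : ℝ) (dist x y), γ s ∈ A ∪ B) ∧
      (∀ s ∈ Icc (0 : ℝ) (dist x y), ∀ t ∈ Icc (0 : ℝ) (dist x y), dist (γ s) (γ t) = |s - t|) ∧
      ∀ C ⊆ A ∪ B, IsPreconnected C → x ∈ C → y ∈ C → γ '' Icc 0 (dist x y) ⊆ C := by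
    intro A B tA hA hB hAB x hx y hy
    obtain ⟨γ, h0, h1, h2, h3, h4⟩ := tA x hx y hy
    refine ⟨γ, h0, h1, fun s hs => Or.inl (h2 s hs), h3, fun C hC hCp hxC hyC => ?_⟩
    exact (h4 (C ∩ A) inter_subset_right (hCp.inter_of_glue hA hB hAB hC) ⟨hxC, hx⟩
      ⟨hyC, hy⟩).trans inter_subset_left
  have cross : ∀ A B : Set M, IsRTreeSet A → IsRTreeSet B → IsClosed A → IsClosed B →
      A ∩ B = {h} → (∀ x ∈ A, ∀ y ∈ B, dist x y = dist x h + dist h y) →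
      ∀ x ∈ A, ∀ y ∈ B, ∃ γ : ℝ → M, γ 0 = x ∧ γ (dist x y) = y ∧
      (∀ s ∈ Icc (0 : ℝ) (dist x y), γ s ∈ A ∪ B) ∧
      (∀ s ∈ Icc (0 : ℝ) (dist x y), ∀ t ∈ Icc (0 : ℝ) (dist x y), dist (γ s) (γ t) = |s - t|) ∧
      ∀ C ⊆ A ∪ B, IsPreconnected C → x ∈ C → y ∈ C → γ '' Icc 0 (dist x y) ⊆ C := by
    intro A B tA tB hA hB hAB hd x hx y hy
    have hhA : h ∈ A := (hAB.ge rfl).1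
    have hhB : h ∈ B := (hAB.ge rfl).2
    obtain ⟨γ, h0, h1, h2, h3, h4⟩ := tA x hx h hhA
    obtain ⟨δ, k0, k1, k2, k3, k4⟩ := tB h hhB y hy
    rw [hd x hx y hy]
    set a := dist x h with ha
    set b := dist h y with hb
    have ha0 : 0 ≤ a := dist_nonneg
    have hb0 : 0 ≤ b := dist_nonneg
    have e1 : ∀ t ≤ a, (fun t => if t ≤ a then γ t else δ (t - a)) t = γ t := by
      intro t ht; simp [ht]
    have e2 : ∀ t, a ≤ t → (fun t => if t ≤ a then γ t else δ (t - a)) t = δ (t - a) := by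
      intro t ht
      rcases ht.eq_or_lt with rfl | ht
      · simp [h1, k0]
      · simp [not_le.2 ht]
    refine ⟨fun t => if t ≤ a then γ t else δ (t - a), ?_, ?_, ?_, ?_, ?_⟩
    · rw [e1 0 ha0, h0]
    · rw [e2 _ (by linarith)]; simpa using k1
    · intro s hs
      rcases le_total s a with h | h
      · rw [e1 s h]; exact Or.inl (h2 s ⟨hs.1, h⟩)
      · rw [e2 s h]; exact Or.inr (k2 _ ⟨by linarith, by linarith [hs.2]⟩)
    · have mixed : ∀ s ∈ Icc 0 a, ∀ t ∈ Icc a (a + b), dist (γ s) (δ (t - a)) = |s - t| := by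
        intro s hs t ht
        have hs' : t - a ∈ Icc 0 b := ⟨by linarith [ht.1], by linarith [ht.2]⟩
        rw [hd _ (h2 s hs) _ (k2 _ hs')]
        have e3 : dist (γ s) h = |s - a| := by
          rw [← h3 s hs a ⟨ha0, le_rfl⟩, h1]
        have e4 : dist h (δ (t - a)) = |0 - (t - a)| := by
          rw [← k3 0 ⟨le_rfl, hb0⟩ _ hs', k0]
        rw [e3, e4, abs_of_nonpos (by linarith [hs.2]), abs_of_nonpos (by linarith [ht.1]),
          abs_of_nonpos (by linarith [hs.2, ht.1])]
        ring
      intro s hs t ht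
      rcases le_total s a with h | h <;> rcases le_total t a with h' | h'
      · rw [e1 s h, e1 t h']; exact h3 s ⟨hs.1, h⟩ t ⟨ht.1, h'⟩
      · rw [e1 s h, e2 t h']; exact mixed s ⟨hs.1, h⟩ t ⟨h', ht.2⟩
      · rw [e2 s h, e1 t h', dist_comm, abs_sub_comm]; exact mixed t ⟨ht.1, h'⟩ s ⟨h, hs.2⟩
      · rw [e2 s h, e2 t h', k3 (s - a) ⟨by linarith, by linarith [hs.2]⟩ (t - a)
          ⟨by linarith, by linarith [ht.2]⟩]
        congr 1; ring
    · intro C hC hCp hxC hyC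
      have hhC : h ∈ C := by
        obtain ⟨u, huC, hu⟩ := isPreconnected_closed_iff.1 hCp A B hA hB hC ⟨x, hxC, hx⟩
          ⟨y, hyC, hy⟩
        rw [hAB] at hu
        exact hu ▸ huC
      rintro _ ⟨t, ht, rfl⟩
      rcases le_total t a with h' | h'
      · rw [e1 t h']
        exact (h4 (C ∩ A) inter_subset_right (hCp.inter_of_glue hA hB hAB hC) ⟨hxC, hx⟩
          ⟨hhC, hhA⟩ ⟨t, ⟨ht.1, h'⟩, rfl⟩).1
      · rw [e2 t h']
        exact (k4 (C ∩ B) inter_subset_right (hCp.inter_of_glue hB hA (by rwa [inter_comm])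
          (by rwa [union_comm])) ⟨hhC, hhB⟩ ⟨hyC, hy⟩
          ⟨t - a, ⟨by linarith, by linarith [ht.2]⟩, rfl⟩).1
  intro x hx y hy
  rcases hx with hx | hx <;> rcases hy with hy | hy
  · exact same A B tA hA hB hAB x hx y hy
  · exact cross A B tA tB hA hB hAB hd x hx y hy
  · rw [union_comm]
    refine cross B A tB tA hB hA (by rwa [inter_comm]) (fun u hu v hv => ?_) x hx y hy
    rw [dist_comm, hd v hv u hu, dist_comm v h, dist_comm h u, add_comm]
  · rw [union_comm]
    exact same B A tB hB hA (by rwa [inter_comm]) x hx y hy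

/-- The isometric image of an interval is a tree set. -/
theorem isRTreeSet_image_Icc {M : Type*} [MetricSpace M] {φ : ℝ → M} (hφ : Isometry φ) (a : ℝ) :
    IsRTreeSet (φ '' Icc 0 a) := by
  rintro _ ⟨u, hu, rfl⟩ _ ⟨v, hv, rfl⟩
  rw [hφ.dist_eq, Real.dist_eq]
  obtain ⟨σ, hσ, hσ'⟩ : ∃ σ : ℝ, |σ| = 1 ∧ v = u + σ * |u - v| := by
    rcases le_total u v with h | h
    · exact ⟨1, by simp, by rw [abs_of_nonpos (by linarith)]; ring⟩
    · exact ⟨-1, by simp, by rw [abs_of_nonneg (by linarith)]; ring⟩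
  have hseg : ∀ s ∈ Icc 0 |u - v|, u + σ * s ∈ uIcc u v := by
    intro s hs
    rw [mem_uIcc]
    rcases (abs_eq zero_le_one).1 hσ with rfl | rfl
    · left; constructor <;> linarith [hs.1, hs.2]
    · right; constructor <;> linarith [hs.1, hs.2]
  refine ⟨fun s => φ (u + σ * s), by simp, by simp [← hσ'], fun s hs => ⟨_, ?_, rfl⟩, ?_, ?_⟩
  · exact ordConnected_Icc.uIcc_subset hu hv (hseg s hs)
  · intro s _ t _
    rw [hφ.dist_eq, Real.dist_eq, show u + σ * s - (u + σ * t) = σ * (s - t) by ring, abs_mul, hσ,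
      one_mul]
  · intro C hC hCp hu' hv'
    have hCeq : φ '' (φ ⁻¹' C) = C :=
      image_preimage_eq_of_subset fun z hz => by
        obtain ⟨w, -, rfl⟩ := hC hz
        exact ⟨w, rfl⟩
    have hpre : IsPreconnected (φ ⁻¹' C) := by
      rw [← hφ.isEmbedding.isInducing.isPreconnected_image, hCeq]
      exact hCp
    rintro _ ⟨s, hs, rfl⟩
    exact hpre.ordConnected.uIcc_subset hu' hv' (hseg s hs)

/-- A tree set is an `ℝ`-tree. A self-avoiding path between two points covers the geodesic since its
image is connected; it has no other point since the part of the parameter interval that is sent to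
the geodesic is connected, by compactness of the interval. -/
theorem IsRTreeSet.isRTree {M : Type*} [MetricSpace M] {A : Set M} (hA : IsRTreeSet A) :
    IsRTree ↥A := by
  rintro ⟨x, hx⟩ ⟨y, hy⟩
  obtain ⟨γ, h0, h1, h2, h3, h4⟩ := hA x hx y hy
  rw [Subtype.dist_eq]
  set d := dist x y with hd
  have hd0 : 0 ≤ d := dist_nonneg
  -- `γ` lies in `A` only on `[0, d]`: outside of this interval it is replaced by constants
  have hmem : ∀ s : ℝ, γ (projIcc 0 d hd0 s) ∈ A := fun s => h2 _ (projIcc 0 d hd0 s).2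
  have hδ : ∀ s (hs : s ∈ Icc 0 d), ((⟨γ (projIcc 0 d hd0 s), hmem s⟩ : ↥A) : M) = γ s := by
    intro s hs
    simp [projIcc_of_mem hd0 hs]
  have hδ' : ∀ s ∈ Icc 0 d, ∀ t ∈ Icc 0 d,
      dist (⟨γ (projIcc 0 d hd0 s), hmem s⟩ : ↥A) ⟨γ (projIcc 0 d hd0 t), hmem t⟩ = |s - t| := by
    intro s hs t ht
    rw [Subtype.dist_eq, hδ s hs, hδ t ht]
    exact h3 s hs t ht
  refine ⟨fun s => ⟨γ (projIcc 0 d hd0 s), hmem s⟩, ?_, ?_, hδ', ?_⟩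
  · apply Subtype.ext; rw [hδ 0 ⟨le_rfl, hd0⟩, h0]
  · apply Subtype.ext; rw [hδ d ⟨hd0, le_rfl⟩, h1]
  · intro f hf hinj hf0 hf1
    set δ : ℝ → ↥A := fun s => ⟨γ (projIcc 0 d hd0 s), hmem s⟩ with hδdef
    have hδc : ContinuousOn δ (Icc 0 d) := by
      have : LipschitzOnWith 1 δ (Icc 0 d) := LipschitzOnWith.of_dist_le_mul fun s hs t ht => by
        rw [hδ' s hs t ht, Real.dist_eq]; simp
      exact this.continuousOn
    have hsub : δ '' Icc 0 d ⊆ f '' Icc 0 1 := by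
      have hC := h4 (Subtype.val '' (f '' Icc 0 1)) (by rintro _ ⟨z, -, rfl⟩; exact z.2)
        ((isPreconnected_Icc.image f hf).image _ continuous_subtype_val.continuousOn)
        ⟨_, ⟨0, by simp, hf0⟩, rfl⟩ ⟨_, ⟨1, by simp, hf1⟩, rfl⟩
      rintro _ ⟨s, hs, rfl⟩
      obtain ⟨z, hz, hz'⟩ := hC ⟨s, hs, rfl⟩
      rw [← hδ s hs] at hz'
      have : z = δ s := Subtype.ext hz'
      exact this ▸ hz
    refine Subset.antisymm ?_ hsub
    set F : Icc (0 : ℝ) 1 → ↥A := (Icc (0 : ℝ) 1).domRestrict f with hF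
    have hFc : Continuous F := continuousOn_iff_continuous_domRestrict.1 hf
    have hFi : Function.Injective F := injOn_iff_injective.1 hinj
    have hFe := hFc.isClosedEmbedding hFi
    set K : Set (Icc (0 : ℝ) 1) := F ⁻¹' (δ '' Icc 0 d) with hK
    have hFK : F '' K = δ '' Icc 0 d := by
      refine image_preimage_eq_of_subset fun z hz => ?_
      obtain ⟨s, hs, rfl⟩ := hsub hz
      exact ⟨⟨s, hs⟩, rfl⟩
    have hKp : IsPreconnected K := by
      rw [← hFe.isEmbedding.isInducing.isPreconnected_image, hFK]
      exact isPreconnected_Icc.image δ hδc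
    have hK0 : (⟨0, by simp⟩ : Icc (0 : ℝ) 1) ∈ K := by
      refine ⟨0, ⟨le_rfl, hd0⟩, ?_⟩
      change _ = f 0
      rw [hf0]; apply Subtype.ext; rw [hδ 0 ⟨le_rfl, hd0⟩, h0]
    have hK1 : (⟨1, by simp⟩ : Icc (0 : ℝ) 1) ∈ K := by
      refine ⟨d, ⟨hd0, le_rfl⟩, ?_⟩
      change _ = f 1
      rw [hf1]; apply Subtype.ext; rw [hδ d ⟨hd0, le_rfl⟩, h1]
    have hall : ∀ z, z ∈ K := fun z => hKp.ordConnected.out hK0 hK1 ⟨z.2.1, z.2.2⟩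
    rintro _ ⟨s, hs, rfl⟩
    exact hall ⟨s, hs⟩

/-! ### The norm of `ℓ¹` -/

theorem lp_one_hasSum_norm {ι : Type*} (f : lp (fun _ : ι => ℝ) 1) :
    HasSum (fun i => |f i|) ‖f‖ := by
  simpa using lp.hasSum_norm (p := 1) (by simp) f

theorem lp_one_norm_add_of_disjoint {ι : Type*} (f g : lp (fun _ : ι => ℝ) 1)
    (h : ∀ i, f i = 0 ∨ g i = 0) : ‖f + g‖ = ‖f‖ + ‖g‖ := by
  refine (lp_one_hasSum_norm (f + g)).unique ?_
  convert (lp_one_hasSum_norm f).add (lp_one_hasSum_norm g) using 2 with i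
  rw [lp.coeFn_add, Pi.add_apply]
  rcases h i with h | h <;> simp [h]

/-- Points between two points of `ℓ¹` that agree in one coordinate have this coordinate too. -/
theorem lp_one_apply_eq_of_dist_add {ι : Type*} {x y z : lp (fun _ : ι => ℝ) 1} {i : ι}
    (h : dist x z + dist z y = dist x y) (hxy : x i = y i) : z i = x i := by
  have hs := ((lp_one_hasSum_norm (x - z)).add (lp_one_hasSum_norm (z - y))).sub
    (lp_one_hasSum_norm (x - y))
  rw [← dist_eq_norm, ← dist_eq_norm, ← dist_eq_norm, h, sub_self] at hs
  have hi := (hasSum_zero_iff_of_nonneg (fun q => by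
    simp only [lp.coeFn_sub, Pi.sub_apply]
    linarith [abs_sub_le (x q) (z q) (y q)])).1 hs
  have := congrFun hi i
  simp only [lp.coeFn_sub, Pi.sub_apply, Pi.zero_apply, hxy, sub_self, abs_zero, sub_zero] at this
  rw [hxy]
  have h1 := abs_nonneg (y i - z i)
  have h2 := abs_nonneg (z i - y i)
  have h3 : |z i - y i| = 0 := by linarith
  linarith [abs_eq_zero.1 h3]

/-! ### Stick-breaking trees -/

/-- The `i`-th unit vector of `ℓ¹`. -/
noncomputable abbrev unitVec (i : ℕ) : EllOne := lp.single 1 i (1 : ℝ)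

theorem add_smul_unitVec_apply_self (x : EllOne) (s : ℝ) (i : ℕ) :
    (x + s • unitVec i) i = x i + s := by
  change x i + s * unitVec i i = _
  rw [lp.single_apply_self, mul_one]

theorem add_smul_unitVec_apply_ne (x : EllOne) (s : ℝ) {i q : ℕ} (h : q ≠ i) :
    (x + s • unitVec i) q = x q := by
  change x q + s * unitVec i q = _
  rw [lp.single_apply_ne _ _ _ h, mul_zero, add_zero]

theorem sum_smul_unitVec_apply (x : ℕ → ℝ) {i q : ℕ} (hq : q ≤ i) :
    (∑ q ∈ Finset.range (i + 1), x q • unitVec q : EllOne) q = x q := by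
  rw [lp.coeFn_sum, Finset.sum_apply, Finset.sum_eq_single q]
  · change x q * unitVec q q = _
    rw [lp.single_apply_self, mul_one]
  · intro q' _ hne
    change x q' * unitVec q' q = 0
    rw [lp.single_apply_ne _ _ _ hne.symm, mul_zero]
  · intro h
    exact absurd (Finset.mem_range.2 (by omega)) h

theorem norm_add_smul_unitVec {x : EllOne} {i : ℕ} (hx : x i = 0) (s : ℝ) :
    ‖x + s • unitVec i‖ = ‖x‖ + |s| := by
  rw [lp_one_norm_add_of_disjoint]
  · rw [norm_smul, lp.norm_single (by simp)]; simp
  · intro q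
    rcases eq_or_ne q i with rfl | h
    · exact Or.inl hx
    · right
      change s * unitVec i q = 0
      rw [lp.single_apply_ne _ _ _ h, mul_zero]

/-- The first `m` sticks of a stick-breaking construction. -/
structure IsStickBreakingUpTo (m : ℕ) (H L : ℕ → EllOne) : Prop where
  start : H 0 = 0
  branch : ∀ i < m, 1 ≤ i → ∃ j < i, H i ∈ segment ℝ (H j) (L j)
  stick : ∀ i < m, ∃ a : ℝ, 0 < a ∧ L i = H i + a • unitVec i

theorem IsStickBreaking.upTo {H L : ℕ → EllOne} (h : IsStickBreaking H L) (m : ℕ) :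
    IsStickBreakingUpTo m H L :=
  ⟨h.start, fun i _ hi => h.branch i hi, fun i _ => h.stick i⟩

theorem segment_add_smul_unitVec (x : EllOne) (i : ℕ) {a : ℝ} (ha : 0 ≤ a) :
    segment ℝ x (x + a • unitVec i) = (fun s : ℝ => x + s • unitVec i) '' Icc 0 a := by
  rw [segment_eq_image']
  ext z
  constructor
  · rintro ⟨θ, hθ, rfl⟩
    refine ⟨θ * a, ⟨mul_nonneg hθ.1 ha, mul_le_of_le_one_left ha hθ.2⟩, ?_⟩
    simp [mul_smul]
  · rintro ⟨s, hs, rfl⟩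
    rcases ha.eq_or_lt with rfl | ha
    · have : s = 0 := le_antisymm hs.2 hs.1
      exact ⟨0, by simp, by simp [this]⟩
    · refine ⟨s / a, ⟨div_nonneg hs.1 ha.le, div_le_one_of_le₀ hs.2 ha.le⟩, ?_⟩
      simp only [add_sub_cancel_left, smul_smul, div_mul_cancel₀ _ ha.ne']

theorem isometry_add_smul_unitVec (x : EllOne) (i : ℕ) :
    Isometry (fun s : ℝ => x + s • unitVec i) := by
  refine Isometry.of_dist_eq fun s t => ?_
  rw [dist_add_left, dist_eq_norm, ← sub_smul, norm_smul, lp.norm_single (by simp), Real.dist_eq]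
  simp

theorem stickTree_succ (H L : ℕ → EllOne) (m : ℕ) :
    stickTree H L (m + 1) = stickTree H L m ∪ segment ℝ (H m) (L m) := by
  ext z
  simp only [stickTree, mem_ofPred_eq, mem_union, Nat.lt_succ_iff_lt_or_eq, or_and_right, exists_or,
    exists_eq_left]

theorem stickTree_one (H L : ℕ → EllOne) : stickTree H L 1 = segment ℝ (H 0) (L 0) := by
  rw [stickTree_succ]
  simp [stickTree]

namespace IsStickBreakingUpTo

variable {m : ℕ} {H L : ℕ → EllOne}

theorem mono (h : IsStickBreakingUpTo m H L) {p : ℕ} (hp : p ≤ m) : IsStickBreakingUpTo p H L :=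
  ⟨h.start, fun i hi => h.branch i (hi.trans_le hp), fun i hi => h.stick i (hi.trans_le hp)⟩

theorem exists_segment_eq (h : IsStickBreakingUpTo m H L) {i : ℕ} (hi : i < m) :
    ∃ a : ℝ, 0 < a ∧ L i = H i + a • unitVec i ∧
      segment ℝ (H i) (L i) = (fun s : ℝ => H i + s • unitVec i) '' Icc 0 a := by
  obtain ⟨a, ha, hL⟩ := h.stick i hi
  exact ⟨a, ha, hL, by rw [hL, segment_add_smul_unitVec _ _ ha.le]⟩

theorem apply_of_mem_segment (h : IsStickBreakingUpTo m H L) {i q : ℕ} (hi : i < m) (hq : q ≠ i)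
    {z : EllOne} (hz : z ∈ segment ℝ (H i) (L i)) : z q = H i q := by
  obtain ⟨a, ha, hL, hs⟩ := h.exists_segment_eq hi
  rw [hs] at hz
  obtain ⟨s, -, rfl⟩ := hz
  exact add_smul_unitVec_apply_ne _ _ hq

theorem start_apply_eq_zero (h : IsStickBreakingUpTo m H L) {i q : ℕ} (hi : i < m) (hq : i ≤ q) :
    H i q = 0 := by
  induction i using Nat.strong_induction_on with
  | _ i ih =>
    rcases Nat.eq_zero_or_pos i with rfl | hi0
    · rw [h.start]; rfl
    · obtain ⟨j, hj, hz⟩ := h.branch i hi hi0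
      rw [h.apply_of_mem_segment (hj.trans hi) (by omega) hz, ih j hj (hj.trans hi) (by omega)]

theorem apply_eq_zero_of_mem_segment (h : IsStickBreakingUpTo m H L) {i q : ℕ} (hi : i < m)
    (hq : i < q) {z : EllOne} (hz : z ∈ segment ℝ (H i) (L i)) : z q = 0 := by
  rw [h.apply_of_mem_segment hi hq.ne' hz, h.start_apply_eq_zero hi hq.le]

theorem apply_eq_zero_of_mem (h : IsStickBreakingUpTo m H L) {q : ℕ} (hq : m ≤ q)
    {z : EllOne} (hz : z ∈ stickTree H L m) : z q = 0 := by
  obtain ⟨i, hi, hz⟩ := hz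
  exact h.apply_eq_zero_of_mem_segment hi (hi.trans_le hq) hz

theorem zero_mem (h : IsStickBreakingUpTo m H L) (hm : 0 < m) : 0 ∈ stickTree H L m :=
  ⟨0, hm, by rw [← h.start]; exact left_mem_segment ℝ _ _⟩

theorem leaf_apply_self_pos (h : IsStickBreakingUpTo m H L) {i : ℕ} (hi : i < m) : 0 < L i i := by
  obtain ⟨a, ha, hL⟩ := h.stick i hi
  rw [hL, add_smul_unitVec_apply_self, h.start_apply_eq_zero hi le_rfl]
  linarith

theorem leaf_mem {i : ℕ} (hi : i < m) : L i ∈ stickTree H L m :=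
  ⟨i, hi, right_mem_segment ℝ _ _⟩

theorem leaf_ne_zero (h : IsStickBreakingUpTo m H L) {i : ℕ} (hi : i < m) : L i ≠ 0 := by
  intro h0
  have := h.leaf_apply_self_pos hi
  rw [h0] at this
  exact lt_irrefl _ this

theorem leaf_injOn (h : IsStickBreakingUpTo m H L) : InjOn L (Iio m) := by
  have key : ∀ i j, j < m → i < j → L i ≠ L j := by
    intro i j hj hij he
    have h1 := h.leaf_apply_self_pos hj
    rw [← he, h.apply_eq_zero_of_mem_segment (hij.trans hj) hij (right_mem_segment ℝ _ _)] at h1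
    exact lt_irrefl _ h1
  intro i hi j hj he
  rcases lt_trichotomy i j with hij | hij | hij
  · exact (key i j hj hij he).elim
  · exact hij
  · exact (key j i hi hij he.symm).elim

theorem isCompact_segment (h : IsStickBreakingUpTo m H L) {i : ℕ} (hi : i < m) :
    IsCompact (segment ℝ (H i) (L i)) := by
  obtain ⟨a, -, -, hs⟩ := h.exists_segment_eq hi
  rw [hs]
  exact isCompact_Icc.image (isometry_add_smul_unitVec _ _).continuous

theorem isCompact (h : IsStickBreakingUpTo m H L) : IsCompact (stickTree H L m) := by
  induction m with
  | zero => simp [stickTree]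
  | succ m ih =>
    rw [stickTree_succ]
    exact (ih (h.mono m.le_succ)).union (h.isCompact_segment m.lt_succ_self)

theorem isRTreeSet (h : IsStickBreakingUpTo m H L) : IsRTreeSet (stickTree H L m) := by
  induction m with
  | zero => intro x hx; simp [stickTree] at hx
  | succ m ih =>
    obtain ⟨a, ha, hL, hs⟩ := h.exists_segment_eq m.lt_succ_self
    have hm := h.mono m.le_succ
    have hseg : IsRTreeSet (segment ℝ (H m) (L m)) := by
      rw [hs]; exact isRTreeSet_image_Icc (isometry_add_smul_unitVec _ _) a
    rcases Nat.eq_zero_or_pos m with rfl | hm0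
    · rw [stickTree_one]; exact hseg
    · rw [stickTree_succ]
      have hHm : H m m = 0 := h.start_apply_eq_zero m.lt_succ_self le_rfl
      refine IsRTreeSet.union (h := H m) (ih hm) hseg hm.isCompact.isClosed
        (h.isCompact_segment m.lt_succ_self).isClosed ?_ ?_
      · ext z
        constructor
        · rintro ⟨hz, hz'⟩
          rw [hs] at hz'
          obtain ⟨s, -, rfl⟩ := hz'
          have := hm.apply_eq_zero_of_mem le_rfl hz
          rw [add_smul_unitVec_apply_self, hHm, zero_add] at this
          simp [this]
        · rintro rfl
          obtain ⟨j, hj, hz⟩ := h.branch m m.lt_succ_self hm0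
          exact ⟨⟨j, hj, hz⟩, left_mem_segment ℝ _ _⟩
      · intro x hx y hy
        rw [hs] at hy
        obtain ⟨s, -, rfl⟩ := hy
        have h1 : (H m - x) m = 0 := by
          rw [lp.coeFn_sub, Pi.sub_apply, hHm, hm.apply_eq_zero_of_mem le_rfl hx, sub_zero]
        have h2 := norm_add_smul_unitVec h1 s
        have h3 := norm_add_smul_unitVec (x := 0) (i := m) rfl s
        rw [dist_comm x, dist_comm x, dist_comm (H m) (_ + _), dist_eq_norm, dist_eq_norm,
          dist_eq_norm, add_sub_cancel_left, add_sub_right_comm, h2]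
        rw [zero_add, norm_zero, zero_add] at h3
        rw [h3]

/-- The part of the tree carried by the first `p` coordinates is the tree of the first `p`
sticks. -/
theorem mem_of_apply_eq_zero (h : IsStickBreakingUpTo m H L) {p : ℕ} (hp : 0 < p) {z : EllOne}
    (hz : z ∈ stickTree H L m) (h0 : ∀ q, p ≤ q → z q = 0) : z ∈ stickTree H L p := by
  obtain ⟨i, hi, hz⟩ := hz
  induction i using Nat.strong_induction_on with
  | _ i ih =>
    rcases lt_or_ge i p with hip | hip
    · exact ⟨i, hip, hz⟩
    · obtain ⟨j, hj, hb⟩ := h.branch i hi (by omega)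
      obtain ⟨a, -, -, hs⟩ := h.exists_segment_eq hi
      refine ih j hj (hj.trans hi) ?_
      rw [hs] at hz
      obtain ⟨s, -, rfl⟩ := hz
      have h1 := h0 i hip
      rw [add_smul_unitVec_apply_self, h.start_apply_eq_zero hi le_rfl, zero_add] at h1
      simpa [h1] using hb

theorem stickTree_eq_treeSpan (h : IsStickBreakingUpTo m H L) {p : ℕ} (hp : 0 < p) (hpm : p ≤ m) :
    stickTree H L p = treeSpan (stickTree H L m) ({0} ∪ {x | ∃ i < p, x = L i}) := by
  ext z
  constructor
  · rintro ⟨i, hi, hz⟩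
    refine ⟨⟨i, hi.trans_le hpm, hz⟩, 0, Or.inl rfl, L i, Or.inr ⟨i, hi, rfl⟩, ?_⟩
    obtain ⟨a, ha, hL, hs⟩ := h.exists_segment_eq (hi.trans_le hpm)
    rw [hs] at hz
    obtain ⟨s, hs, rfl⟩ := hz
    have h0 := h.start_apply_eq_zero (hi.trans_le hpm) le_rfl
    rw [hL, (isometry_add_smul_unitVec (H i) i).dist_eq s a, dist_comm, dist_comm 0, dist_zero_right,
      dist_zero_right, norm_add_smul_unitVec h0, norm_add_smul_unitVec h0, Real.dist_eq,
      abs_of_nonneg hs.1, abs_of_nonneg ha.le, abs_of_nonpos (by linarith [hs.2])]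
    ring
  · rintro ⟨hz, x, hx, y, hy, hd⟩
    refine h.mem_of_apply_eq_zero hp hz fun q hq => ?_
    have h0 : ∀ x ∈ ({0} ∪ {x | ∃ i < p, x = L i} : Set EllOne), x q = 0 := by
      rintro x (rfl | ⟨i, hi, rfl⟩)
      · rfl
      · exact (h.mono hpm).apply_eq_zero_of_mem hq (leaf_mem hi)
    rw [lp_one_apply_eq_of_dist_add hd ((h0 x hx).trans (h0 y hy).symm), h0 x hx]

/-! ### Leaves of stick-breaking trees -/

/-- The tree stays connected when the end of a stick is removed, provided that no stick starts
there. -/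
theorem isPreconnected_diff_leaf (h : IsStickBreakingUpTo m H L)
    (hHL : ∀ i < m, ∀ j < m, H i ≠ L j) {l : ℕ} (hl : l < m) {p : ℕ} (hp : p ≤ m) :
    IsPreconnected (stickTree H L p \ {L l}) := by
  induction p with
  | zero => simp [stickTree, isPreconnected_empty]
  | succ p ih =>
    have hpm : p < m := hp
    obtain ⟨a, ha, hL, hs⟩ := h.exists_segment_eq hpm
    have hinj := (isometry_add_smul_unitVec (H p) p).injective
    have hseg : IsPreconnected (segment ℝ (H p) (L p) \ {L l}) := by
      rw [hs]
      rcases eq_or_ne p l with rfl | hpl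
      · have : (fun s : ℝ => H p + s • unitVec p) '' Icc 0 a \ {L p}
            = (fun s : ℝ => H p + s • unitVec p) '' Ico 0 a := by
          rw [hL, ← image_singleton (f := fun s : ℝ => H p + s • unitVec p), ← image_sdiff hinj,
            Icc_sdiff_right]
        rw [this]
        exact isPreconnected_Ico.image _ (isometry_add_smul_unitVec _ _).continuous.continuousOn
      · rw [sdiff_singleton_eq_self]
        · exact isPreconnected_Icc.image _ (isometry_add_smul_unitVec _ _).continuous.continuousOn
        · rw [← hs]
          intro hmem
          rcases lt_or_gt_of_ne hpl with hlt | hlt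
          · have h1 := h.leaf_apply_self_pos hl
            rw [h.apply_eq_zero_of_mem_segment hpm hlt hmem] at h1
            exact lt_irrefl _ h1
          · have h1 := h.apply_eq_zero_of_mem_segment hl hlt (right_mem_segment ℝ (H l) (L l))
            rw [hs] at hmem
            obtain ⟨s, -, hs'⟩ := hmem
            simp only at hs'
            rw [← hs', add_smul_unitVec_apply_self, h.start_apply_eq_zero hpm le_rfl, zero_add] at h1
            rw [h1, zero_smul, add_zero] at hs'
            exact hHL p hpm l hl hs'
    rcases Nat.eq_zero_or_pos p with rfl | hp0
    · rwa [stickTree_one]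
    · rw [stickTree_succ, union_sdiff_distrib]
      obtain ⟨j, hj, hb⟩ := h.branch p hpm hp0
      exact IsPreconnected.union (H p) ⟨⟨j, hj, hb⟩, hHL p hpm l hl⟩
        ⟨left_mem_segment ℝ _ _, hHL p hpm l hl⟩ (ih hpm.le) hseg

/-- An interior point of a stick disconnects the tree: beyond and before it, the coordinate of the
stick is above, resp. below, the coordinate of the point, and this coordinate is constant on all the
other sticks. -/
theorem not_isPreconnected_diff (h : IsStickBreakingUpTo m H L) {x : EllOne}
    (hx : x ∈ stickTree H L m) (hx0 : x ≠ 0) (hxL : ∀ i < m, x ≠ L i) :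
    ¬ IsPreconnected (stickTree H L m \ {x}) := by
  classical
  obtain ⟨j, ⟨hj, hxj⟩, hmin⟩ := Nat.findX (p := fun j => j < m ∧ x ∈ segment ℝ (H j) (L j)) hx
  obtain ⟨a, ha, hL, hs⟩ := h.exists_segment_eq hj
  have hxj' := hxj
  rw [hs] at hxj'
  obtain ⟨t, ht, rfl⟩ := hxj'
  have ht0 : t ≠ 0 := by
    rintro rfl
    simp only [zero_smul, add_zero] at hx0 hmin
    rcases Nat.eq_zero_or_pos j with rfl | hj0
    · exact hx0 h.start
    · obtain ⟨i, hi, hb⟩ := h.branch j hj hj0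
      exact hmin i hi ⟨hi.trans hj, hb⟩
  have hta : t ≠ a := by
    rintro rfl
    exact hxL j hj hL.symm
  have htpos : 0 < t := lt_of_le_of_ne ht.1 (Ne.symm ht0)
  have hta' : t < a := lt_of_le_of_ne ht.2 hta
  have hHj := h.start_apply_eq_zero hj le_rfl
  have hcont : Continuous fun z : EllOne => z j := (lp.lipschitzWith_one_eval 1 j).continuous
  set x := H j + t • unitVec j with hxdef
  have hxt : x j = t := by rw [hxdef, add_smul_unitVec_apply_self, hHj, zero_add]
  -- the points that are not beyond `x`, stick by stick
  set B : ℕ → Set EllOne := fun i =>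
    if i = j then (fun s : ℝ => H j + s • unitVec j) '' Icc 0 t
    else if H i j < t then segment ℝ (H i) (L i) else ∅ with hB
  have hBc : IsClosed (⋃ i ∈ Finset.range m, B i) := by
    refine isClosed_biUnion_finset fun i hi => ?_
    rw [hB]
    dsimp only
    split_ifs with h1 h2
    · exact (isCompact_Icc.image (isometry_add_smul_unitVec _ _).continuous).isClosed
    · exact (h.isCompact_segment (Finset.mem_range.1 hi)).isClosed
    · exact isClosed_empty
  have hBlt : ∀ z, z ∈ (⋃ i ∈ Finset.range m, B i) → z = x ∨ z j < t := by
    intro z hz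
    simp only [mem_iUnion, Finset.mem_range, exists_prop] at hz
    obtain ⟨i, hi, hz⟩ := hz
    rw [hB] at hz
    dsimp only at hz
    split_ifs at hz with h1 h2
    · obtain ⟨s, hs, rfl⟩ := hz
      rcases hs.2.eq_or_lt with rfl | hlt
      · exact Or.inl rfl
      · right
        simp only
        rw [add_smul_unitVec_apply_self, hHj, zero_add]; exact hlt
    · right; rw [h.apply_of_mem_segment hi (Ne.symm h1) hz]; exact h2
    · exact hz.elim
  rw [isPreconnected_closed_iff]
  push Not
  refine ⟨⋃ i ∈ Finset.range m, B i, {z | t ≤ z j}, hBc, isClosed_le continuous_const hcont,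
    ?_, ?_, ?_, ?_⟩
  · rintro z ⟨⟨i, hi, hz⟩, -⟩
    rcases le_or_gt t (z j) with h1 | h1
    · exact Or.inr h1
    · left
      simp only [mem_iUnion, Finset.mem_range, exists_prop]
      refine ⟨i, hi, ?_⟩
      rw [hB]
      dsimp only
      split_ifs with h2 h3
      · subst h2
        rw [hs] at hz
        obtain ⟨s, hs, rfl⟩ := hz
        simp only at h1
        rw [add_smul_unitVec_apply_self, hHj, zero_add] at h1
        exact ⟨s, ⟨hs.1, h1.le⟩, rfl⟩
      · exact hz
      · exact h3 (by rwa [← h.apply_of_mem_segment hi (Ne.symm h2) hz])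
  · refine ⟨0, ⟨h.zero_mem (by omega), fun h0 => hx0 h0.symm⟩, ?_⟩
    simp only [mem_iUnion, Finset.mem_range, exists_prop]
    refine ⟨0, by omega, ?_⟩
    rw [hB]
    dsimp only
    split_ifs with h2 h3
    · subst h2; exact ⟨0, ⟨le_rfl, ht.1⟩, by simp [h.start]⟩
    · rw [← h.start]; exact left_mem_segment ℝ _ _
    · exact h3 (by rw [h.start]; exact htpos)
  · refine ⟨L j, ⟨leaf_mem hj, fun h0 => hxL j hj h0.symm⟩, ?_⟩
    rw [mem_ofPred_eq, hL, add_smul_unitVec_apply_self, hHj, zero_add]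
    exact hta'.le
  · rw [eq_empty_iff_forall_notMem]
    rintro z ⟨⟨-, hzx⟩, hz1, hz2⟩
    rcases hBlt z hz1 with h1 | h1
    · exact hzx h1
    · exact absurd hz2 (not_le.2 h1)

theorem treeLeaves_eq (h : IsStickBreakingUpTo m H L) (hHL : ∀ i < m, ∀ j < m, H i ≠ L j) :
    treeLeaves (stickTree H L m) 0 = {x | ∃ i < m, x = L i} := by
  ext x
  constructor
  · rintro ⟨hx, hx0, hcard⟩
    by_contra hcon
    refine h.not_isPreconnected_diff hx hx0 (fun i hi he => hcon ⟨i, hi, he⟩) ?_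
    have := (Nat.card_eq_one_iff_unique.1 hcard).1
    rw [isPreconnected_iff_preconnectedSpace]
    exact preconnectedSpace_iff_connectedComponent.2 fun a =>
      eq_univ_of_forall fun b => ConnectedComponents.coe_eq_coe'.1 (Subsingleton.elim _ _)
  · rintro ⟨i, hi, rfl⟩
    refine ⟨leaf_mem hi, h.leaf_ne_zero hi, ?_⟩
    have hp := isPreconnected_iff_preconnectedSpace.1 (h.isPreconnected_diff_leaf hHL hi le_rfl)
    rw [Nat.card_eq_one_iff_unique]
    refine ⟨⟨fun a b => ?_⟩, ⟨ConnectedComponents.mk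
      ⟨0, h.zero_mem (by omega), (h.leaf_ne_zero hi).symm⟩⟩⟩
    obtain ⟨a, rfl⟩ := ConnectedComponents.surjective_coe a
    obtain ⟨b, rfl⟩ := ConnectedComponents.surjective_coe b
    rw [ConnectedComponents.coe_eq_coe', preconnectedSpace_iff_connectedComponent.1 hp b]
    trivial

theorem ncard_leaves (h : IsStickBreakingUpTo m H L) : {x | ∃ i < m, x = L i}.ncard = m := by
  have : {x | ∃ i < m, x = L i} = L '' Iio m := by
    ext x; simp [eq_comm]
  rw [this, h.leaf_injOn.ncard_image, Set.ncard_eq_toFinset_card']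
  simp

end IsStickBreakingUpTo

/-! ### Genealogies of rooted trees -/

namespace TreeVertex

/-- A combinatorial description of a rooted tree that is spanned by its root and its leaves:
`par v` is the parent of the vertex `v`, `anc v` is the set of the vertices other than the root on
the path from the root to `v`, and `owner v` is the smallest number of a leaf below `v`. The
vertices with owner `i` form the `i`-th stick of the tree. The values at names that are not in use
are irrelevant. -/
structure Genealogy where
  par : TreeVertex → TreeVertex
  anc : TreeVertex → Finset TreeVertex
  owner : TreeVertex → ℕ

namespace Genealogy

/-- `g` describes the tree `G` whose vertices are the root and the elements of `V`. -/
structure Describes (g : Genealogy) (V : Finset TreeVertex) (G : SimpleGraph TreeVertex) :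
    Prop where
  root_notMem : root ∉ V
  anc_root : g.anc root = ∅
  par_mem : ∀ v ∈ V, g.par v ∈ V ∨ g.par v = root
  notMem_anc_par : ∀ v ∈ V, v ∉ g.anc (g.par v)
  mem_anc_iff : ∀ v ∈ V, ∀ w, w ∈ g.anc v ↔ w = v ∨ w ∈ g.anc (g.par v)
  edgeSet_eq : G.edgeSet = (fun v => s(g.par v, v)) '' V
  owner_le : ∀ v ∈ V, ∀ w ∈ g.anc v, g.owner w ≤ g.owner v
  leaf_owner_mem : ∀ v ∈ V, leaf (g.owner v) ∈ V
  mem_anc_leaf_owner : ∀ v ∈ V, v ∈ g.anc (leaf (g.owner v))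
  owner_leaf : ∀ j, g.owner (leaf j) = j
  eq_leaf_of_mem_anc : ∀ v ∈ V, ∀ j, leaf j ∈ g.anc v → v = leaf j

namespace Describes

variable {g : Genealogy} {V : Finset TreeVertex} {G : SimpleGraph TreeVertex}

theorem self_mem_anc (h : g.Describes V G) {v : TreeVertex} (hv : v ∈ V) : v ∈ g.anc v :=
  (h.mem_anc_iff v hv v).2 (Or.inl rfl)

theorem anc_par_ssubset (h : g.Describes V G) {v : TreeVertex} (hv : v ∈ V) :
    g.anc (g.par v) ⊂ g.anc v :=
  (Finset.ssubset_iff_of_subset fun w hw => (h.mem_anc_iff v hv w).2 (Or.inr hw)).2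
    ⟨v, h.self_mem_anc hv, h.notMem_anc_par v hv⟩

/-- Induction along the path to the root. -/
theorem induction (h : g.Describes V G) {P : TreeVertex → Prop} (h0 : P root)
    (h1 : ∀ v ∈ V, (g.par v ∈ V ∨ g.par v = root) → P (g.par v) → P v) {v : TreeVertex}
    (hv : v ∈ V ∨ v = root) : P v := by
  induction hc : (g.anc v).card using Nat.strong_induction_on generalizing v with
  | _ c ih =>
    rcases hv with hv | rfl
    · exact h1 v hv (h.par_mem v hv)
        (ih _ (hc ▸ Finset.card_lt_card (h.anc_par_ssubset hv)) (h.par_mem v hv) rfl)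
    · exact h0

theorem anc_subset (h : g.Describes V G) {v : TreeVertex} (hv : v ∈ V ∨ v = root) :
    g.anc v ⊆ V := by
  refine h.induction (P := fun v => g.anc v ⊆ V) (by simp [h.anc_root]) (fun v hv _ ih w hw => ?_) hv
  rcases (h.mem_anc_iff v hv w).1 hw with rfl | hw
  · exact hv
  · exact ih hw

theorem anc_trans (h : g.Describes V G) {v w : TreeVertex} (hv : v ∈ V ∨ v = root)
    (hw : w ∈ g.anc v) : g.anc w ⊆ g.anc v := by
  refine h.induction (P := fun v => w ∈ g.anc v → g.anc w ⊆ g.anc v) (by simp [h.anc_root])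
    (fun v hv _ ih hw => ?_) hv hw
  rcases (h.mem_anc_iff v hv w).1 hw with rfl | hw
  · exact subset_rfl
  · exact (ih hw).trans (h.anc_par_ssubset hv).subset

/-- The ancestors of a vertex form a chain. -/
theorem anc_total (h : g.Describes V G) {v w w' : TreeVertex} (hv : v ∈ V ∨ v = root)
    (hw : w ∈ g.anc v) (hw' : w' ∈ g.anc v) : w ∈ g.anc w' ∨ w' ∈ g.anc w := by
  refine h.induction (P := fun v => w ∈ g.anc v → w' ∈ g.anc v → w ∈ g.anc w' ∨ w' ∈ g.anc w)
    (by simp [h.anc_root]) (fun v hv _ ih hw hw' => ?_) hv hw hw'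
  rcases (h.mem_anc_iff v hv w).1 hw with rfl | h1
  · exact Or.inr hw'
  · rcases (h.mem_anc_iff v hv w').1 hw' with rfl | h2
    · exact Or.inl hw
    · exact ih h1 h2

theorem anc_antisymm (h : g.Describes V G) {v w : TreeVertex} (hv : v ∈ V)
    (hvw : v ∈ g.anc w) (hwv : w ∈ g.anc v) : v = w := by
  rcases (h.mem_anc_iff v hv w).1 hwv with rfl | h1
  · rfl
  · exact absurd (h.anc_trans (h.par_mem v hv) h1 hvw) (h.notMem_anc_par v hv)

theorem par_ne (h : g.Describes V G) {v : TreeVertex} (hv : v ∈ V) : g.par v ≠ v := fun he =>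
  h.notMem_anc_par v hv (by rw [he]; exact h.self_mem_anc hv)

theorem edge_injOn (h : g.Describes V G) : InjOn (fun v => s(g.par v, v)) (V : Set TreeVertex) := by
  intro v hv w hw he
  rcases Sym2.eq_iff.1 he with ⟨-, h1⟩ | ⟨h1, h2⟩
  · exact h1
  · exfalso
    refine h.notMem_anc_par v hv ?_
    rw [h1, h.mem_anc_iff w hw, ← h2]
    exact Or.inr (h.self_mem_anc hv)

theorem adj_iff (h : g.Describes V G) {a b : TreeVertex} :
    G.Adj a b ↔ (b ∈ V ∧ g.par b = a) ∨ (a ∈ V ∧ g.par a = b) := by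
  rw [← SimpleGraph.mem_edgeSet, h.edgeSet_eq]
  constructor
  · rintro ⟨v, hv, he⟩
    rcases Sym2.eq_iff.1 he with ⟨rfl, rfl⟩ | ⟨rfl, rfl⟩
    · exact Or.inl ⟨hv, rfl⟩
    · exact Or.inr ⟨hv, rfl⟩
  · rintro (⟨hb, rfl⟩ | ⟨ha, rfl⟩)
    · exact ⟨b, hb, rfl⟩
    · exact ⟨a, ha, Sym2.eq_swap⟩

theorem adj_par (h : g.Describes V G) {v : TreeVertex} (hv : v ∈ V) : G.Adj (g.par v) v :=
  h.adj_iff.2 (Or.inl ⟨hv, rfl⟩)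

theorem ncard_edgeSet (h : g.Describes V G) : G.edgeSet.ncard = V.card := by
  rw [h.edgeSet_eq, h.edge_injOn.ncard_image, ncard_coe_finset]

/-! ### Positions and graph distances -/

/-- A walk that enters the subtree below `w` visits the parent of `w`. -/
theorem par_mem_support (h : g.Describes V G) {u v w : TreeVertex} (q : G.Walk u v)
    (hu : w ∉ g.anc u) (hv : w ∈ g.anc v) : g.par w ∈ q.support := by
  induction q with
  | nil => exact absurd hv hu
  | @cons a b c hab q ih =>
    by_cases hb : w ∈ g.anc b
    · rcases h.adj_iff.1 hab with ⟨hbV, rfl⟩ | ⟨haV, rfl⟩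
      · rcases (h.mem_anc_iff b hbV w).1 hb with rfl | hw
        · simp
        · exact absurd hw hu
      · exact absurd ((h.mem_anc_iff a haV w).2 (Or.inr hb)) hu
    · simp [ih hb hv]

theorem support_subset_of_isPath (h : g.Describes V G) {v w : TreeVertex}
    (q : G.Walk root v) (hq : q.IsPath) (hw : w ∈ q.support) (hwr : w ≠ root) : w ∈ g.anc v := by
  classical
  by_contra hwv
  -- otherwise the path visits the parent of `w` before and after `w`
  have hne : ¬ (q.dropUntil w hw).Nil := by
    intro hn
    have := hn.eq
    subst this
    rcases q.not_nil_iff.1 (fun hnil => hwr hnil.eq.symm) with ⟨b, hab, p, rfl⟩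
    have hcV : w ∈ V := by
      rcases h.adj_iff.1 (SimpleGraph.Walk.adj_penultimate (p := .cons hab p) (by simp)) with h1 | h1
      · exact h1.1
      · rcases h.par_mem _ h1.1 with h2 | h2
        · exact h1.2 ▸ h2
        · exact absurd (h1.2.symm.trans h2) hwr
    exact hwv (h.self_mem_anc hcV)
  have hwV : w ∈ V := by
    obtain ⟨b, hab, p, -⟩ := SimpleGraph.Walk.not_nil_iff.1 hne
    rcases h.adj_iff.1 hab with h1 | h1
    · rcases h.par_mem _ h1.1 with h2 | h2
      · exact h1.2 ▸ h2
      · exact absurd (h1.2.symm.trans h2) hwr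
    · exact h1.1
  have hww := h.self_mem_anc hwV
  have h1 : g.par w ∈ (q.takeUntil w hw).support :=
    h.par_mem_support _ (by simp [h.anc_root]) hww
  have h2 : g.par w ∈ (q.dropUntil w hw).support := by
    have := h.par_mem_support (q.dropUntil w hw).reverse hwv hww
    rwa [SimpleGraph.Walk.support_reverse, List.mem_reverse] at this
  have h3 : g.par w ∈ (q.dropUntil w hw).support.tail :=
    ((SimpleGraph.Walk.mem_support_iff _).1 h2).resolve_left (h.par_ne hwV)
  have hnd := hq.support_nodup
  rw [← q.take_spec hw, SimpleGraph.Walk.support_append] at hnd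
  exact (List.nodup_append.1 hnd).2.2 _ h1 _ h3 rfl

theorem exists_isPath (h : g.Describes V G) {v : TreeVertex} (hv : v ∈ V ∨ v = root) :
    ∃ q : G.Walk root v, q.IsPath ∧ ∀ w, w ∈ q.support ↔ w = root ∨ w ∈ g.anc v := by
  refine h.induction (P := fun v => ∃ q : G.Walk root v, q.IsPath ∧
    ∀ w, w ∈ q.support ↔ w = root ∨ w ∈ g.anc v) ?_ ?_ hv
  · exact ⟨.nil, .nil, by simp [h.anc_root]⟩
  · rintro v hv - ⟨q, hq, hs⟩
    refine ⟨q.concat (h.adj_par hv), hq.concat ?_ _, fun w => ?_⟩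
    · rw [hs]
      rintro (rfl | h1)
      · exact h.root_notMem hv
      · exact h.notMem_anc_par v hv h1
    · rw [SimpleGraph.Walk.support_concat, List.mem_append, hs,
        h.mem_anc_iff v hv, List.mem_singleton]
      tauto

open Classical in
theorem position_eq (h : g.Describes V G) {v : TreeVertex} (hv : v ∈ V ∨ v = root) :
    position G v = ∑ w ∈ g.anc v, lp.single 1 w (1 : ℝ) := by
  have hset : {w : TreeVertex | w ≠ root ∧ ∃ q : G.Walk root v, q.IsPath ∧ w ∈ q.support} =
      (g.anc v : Set TreeVertex) := by
    ext w
    constructor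
    · rintro ⟨hw, q, hq, hwq⟩
      exact h.support_subset_of_isPath q hq hwq hw
    · intro hw
      obtain ⟨q, hq, hs⟩ := h.exists_isPath hv
      refine ⟨?_, q, hq, (hs w).2 (Or.inr hw)⟩
      rintro rfl
      exact h.root_notMem (h.anc_subset hv hw)
  rw [position, hset, finsum_mem_coe_finset]

theorem position_root (h : g.Describes V G) : position G root = 0 := by
  classical
  rw [h.position_eq (Or.inr rfl), h.anc_root, Finset.sum_empty]

open Classical in
theorem position_apply (h : g.Describes V G) {v : TreeVertex} (hv : v ∈ V ∨ v = root)
    (w : TreeVertex) : position G v w = if w ∈ g.anc v then 1 else 0 := by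
  rw [h.position_eq hv, lp.coeFn_sum, Finset.sum_apply]
  simp [lp.single_apply, Pi.single_apply]

open Classical in
theorem position_eq_add (h : g.Describes V G) {v : TreeVertex} (hv : v ∈ V) :
    position G v = position G (g.par v) + lp.single 1 v (1 : ℝ) := by
  have hanc : g.anc v = insert v (g.anc (g.par v)) := by
    ext w
    rw [h.mem_anc_iff v hv, Finset.mem_insert]
  rw [h.position_eq (Or.inl hv), h.position_eq (h.par_mem v hv), hanc,
    Finset.sum_insert (h.notMem_anc_par v hv), add_comm]

theorem dist_position_of_notMem (h : g.Describes V G) {u v : TreeVertex} (hu : u ∈ V)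
    (hv : v ∈ V ∨ v = root) (huv : u ∉ g.anc v) :
    dist (position G u) (position G v) = dist (position G (g.par u)) (position G v) + 1 := by
  classical
  rw [dist_eq_norm, h.position_eq_add hu, add_sub_right_comm, lp_one_norm_add_of_disjoint,
    lp.norm_single (by simp), dist_eq_norm]
  · simp
  · intro i
    rcases eq_or_ne i u with rfl | hi
    · left
      change position G (g.par i) i - position G v i = 0
      rw [h.position_apply (h.par_mem i hu), h.position_apply hv, if_neg (h.notMem_anc_par i hu),
        if_neg huv, sub_zero]
    · exact Or.inr (lp.single_apply_ne _ _ _ hi)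

theorem dist_position_of_adj (h : g.Describes V G) {u v : TreeVertex} (huv : G.Adj u v) :
    dist (position G u) (position G v) = 1 := by
  rcases h.adj_iff.1 huv with ⟨hv, rfl⟩ | ⟨hu, rfl⟩
  · rw [dist_comm, h.dist_position_of_notMem hv (h.par_mem v hv) (h.notMem_anc_par v hv), dist_self,
      zero_add]
  · rw [h.dist_position_of_notMem hu (h.par_mem u hu) (h.notMem_anc_par u hu), dist_self, zero_add]

theorem exists_walk (h : g.Describes V G) (N : ℕ) : ∀ {u v : TreeVertex}, (u ∈ V ∨ u = root) →
    (v ∈ V ∨ v = root) → (g.anc u).card + (g.anc v).card = N →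
    ∃ q : G.Walk u v, (q.length : ℝ) = dist (position G u) (position G v) := by
  induction N using Nat.strong_induction_on with
  | _ N ih =>
    -- one of the two points is not above the other one: move it to its parent
    have step : ∀ {u v : TreeVertex}, u ∈ V → (v ∈ V ∨ v = root) → u ∉ g.anc v →
        (g.anc u).card + (g.anc v).card = N →
        ∃ q : G.Walk u v, (q.length : ℝ) = dist (position G u) (position G v) := by
      intro u v hu hv huv hN
      obtain ⟨q, hq⟩ := ih _ (by have := Finset.card_lt_card (h.anc_par_ssubset hu); omega)
        (h.par_mem u hu) hv rfl
      exact ⟨.cons (h.adj_par hu).symm q, by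
        rw [SimpleGraph.Walk.length_cons, h.dist_position_of_notMem hu hv huv, ← hq]; push_cast; rfl⟩
    intro u v hu hv hN
    by_cases huv : u = v
    · subst huv
      exact ⟨.nil, by simp⟩
    · by_cases h1 : u ∈ V ∧ u ∉ g.anc v
      · exact step h1.1 hv h1.2 hN
      · have h2 : v ∈ V ∧ v ∉ g.anc u := by
          rcases hv with hv | rfl
          · refine ⟨hv, fun hvu => ?_⟩
            rcases hu with hu | rfl
            · exact huv (h.anc_antisymm hu (by tauto) hvu)
            · simp [h.anc_root] at hvu
          · exfalso
            rcases hu with hu | rfl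
            · exact h1 ⟨hu, by simp [h.anc_root]⟩
            · exact huv rfl
        obtain ⟨q, hq⟩ := step h2.1 hu h2.2 (by omega)
        exact ⟨q.reverse, by rw [SimpleGraph.Walk.length_reverse, hq, dist_comm]⟩

theorem dist_position_le_length (h : g.Describes V G) {u v : TreeVertex} (q : G.Walk u v) :
    dist (position G u) (position G v) ≤ q.length := by
  induction q with
  | nil => simp
  | @cons a b c hab q ih =>
    have := dist_triangle (position G a) (position G b) (position G c)
    rw [h.dist_position_of_adj hab] at this
    rw [SimpleGraph.Walk.length_cons]
    push_cast
    linarith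

/-- The graph distance is the distance of the positions in `ℓ¹`. -/
theorem dist_eq_dist_position (h : g.Describes V G) {u v : TreeVertex} (hu : u ∈ V ∨ u = root)
    (hv : v ∈ V ∨ v = root) : (G.dist u v : ℝ) = dist (position G u) (position G v) := by
  obtain ⟨q, hq⟩ := h.exists_walk _ hu hv rfl
  refine le_antisymm ?_ ?_
  · rw [← hq]; exact_mod_cast SimpleGraph.dist_le q
  · obtain ⟨q', hq'⟩ := SimpleGraph.Reachable.exists_walk_length_eq_dist ⟨q⟩
    rw [← hq']
    exact h.dist_position_le_length q'

open Classical in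
theorem mem_realization_iff (h : g.Describes V G) {z : EdgeSpace} :
    z ∈ realization G ↔ ∃ v ∈ V, ∃ t ∈ Icc (0 : ℝ) 1,
      z = position G (g.par v) + t • lp.single 1 v (1 : ℝ) := by
  have key : ∀ v ∈ V, z ∈ segment ℝ (position G (g.par v)) (position G v) ↔ ∃ t ∈ Icc (0 : ℝ) 1,
      z = position G (g.par v) + t • lp.single 1 v (1 : ℝ) := by
    intro v hv
    rw [segment_eq_image', h.position_eq_add hv]
    simp only [add_sub_cancel_left, mem_image, eq_comm]
  constructor
  · rintro ⟨u, v, huv, hz⟩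
    rcases h.adj_iff.1 huv with ⟨hv, rfl⟩ | ⟨hu, rfl⟩
    · exact ⟨v, hv, (key v hv).1 hz⟩
    · rw [segment_symm] at hz
      exact ⟨u, hu, (key u hu).1 hz⟩
  · rintro ⟨v, hv, hz⟩
    exact ⟨g.par v, v, h.adj_par hv, (key v hv).2 hz⟩

end Describes

end Genealogy

end TreeVertex

/-! ### The genealogy of the growing trees -/

namespace TreeVertex

open Classical in
/-- The leaves that are created together with `node n`. -/
noncomputable def newLeaves (k n : ℕ) : Finset TreeVertex :=
  (Finset.Ico ((k - 1) * n + 1) ((k - 1) * (n + 1) + 1)).image leaf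

open Classical in
/-- The vertices of `T_n` other than the root. -/
noncomputable def verts (k n : ℕ) : Finset TreeVertex :=
  (Finset.range n).image node ∪ (Finset.range ((k - 1) * n + 1)).image leaf

theorem mem_newLeaves {k n : ℕ} {w : TreeVertex} :
    w ∈ newLeaves k n ↔ ∃ j, ((k - 1) * n + 1 ≤ j ∧ j < (k - 1) * (n + 1) + 1) ∧ leaf j = w := by
  simp [newLeaves]

theorem node_mem_verts {k n m : ℕ} : node m ∈ verts k n ↔ m < n := by
  simp [verts]

theorem leaf_mem_verts {k n j : ℕ} : leaf j ∈ verts k n ↔ j < (k - 1) * n + 1 := by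
  simp [verts]

theorem root_notMem_verts {k n : ℕ} : root ∉ verts k n := by
  simp [verts]

theorem verts_zero (k : ℕ) : verts k 0 = {leaf 0} := by
  simp [verts]

theorem mem_verts_succ {k n : ℕ} {w : TreeVertex} :
    w ∈ verts k (n + 1) ↔ w = node n ∨ w ∈ newLeaves k n ∨ w ∈ verts k n := by
  have h : (k - 1) * (n + 1) = (k - 1) * n + (k - 1) := by ring
  rcases w with _ | m | j
  · simp [root_notMem_verts, mem_newLeaves]
  · simp only [node_mem_verts, mem_newLeaves, node.injEq, reduceCtorEq, and_false, exists_false,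
      false_or]
    omega
  · simp only [leaf_mem_verts, mem_newLeaves, leaf.injEq, reduceCtorEq, false_or, exists_eq_right]
    omega

theorem node_notMem_verts {k n : ℕ} : node n ∉ verts k n := by
  simp [node_mem_verts]

theorem node_notMem_newLeaves {k n m : ℕ} : node m ∉ newLeaves k n := by
  simp [mem_newLeaves]

theorem notMem_newLeaves_of_mem_verts {k n : ℕ} {w : TreeVertex} (hw : w ∈ verts k n) :
    w ∉ newLeaves k n := by
  intro h
  obtain ⟨j, hj, rfl⟩ := mem_newLeaves.1 h
  have := leaf_mem_verts.1 hw
  omega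

theorem card_verts {k : ℕ} (hk : 1 ≤ k) (n : ℕ) : (verts k n).card = k * n + 1 := by
  classical
  rw [verts, Finset.card_union_of_disjoint, Finset.card_image_of_injective,
    Finset.card_image_of_injective, Finset.card_range, Finset.card_range]
  · obtain ⟨l, rfl⟩ := Nat.exists_eq_add_of_le hk
    simp only [Nat.add_sub_cancel_left]; ring
  · intro a b h; simpa using h
  · intro a b h; simpa using h
  · rw [Finset.disjoint_left]
    intro w hw hw'
    obtain ⟨a, -, rfl⟩ := Finset.mem_image.1 hw
    obtain ⟨b, -, hb⟩ := Finset.mem_image.1 hw'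
    cases hb

namespace Genealogy

open Classical in
/-- The genealogy of the tree with one edge. -/
noncomputable def init : Genealogy where
  par _ := root
  anc w := if w = leaf 0 then {leaf 0} else ∅
  owner
    | leaf j => j
    | _ => 0

open Classical in
/-- The effect on the genealogy of grafting new leaves on the edge above `v`. -/
noncomputable def graft (k n : ℕ) (g : Genealogy) (v : TreeVertex) : Genealogy where
  par w := if w = v ∨ w ∈ newLeaves k n then node n else if w = node n then g.par v else g.par w
  anc w :=
    if w = node n then insert (node n) (g.anc (g.par v))
    else if w ∈ newLeaves k n then insert w (insert (node n) (g.anc (g.par v)))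
    else if v ∈ g.anc w then insert (node n) (g.anc w) else g.anc w
  owner w := if w = node n then g.owner v else g.owner w

section graft

variable {k n : ℕ} {g : Genealogy} {v w : TreeVertex}

theorem graft_anc_node : w ∈ (graft k n g v).anc (node n) ↔ w = node n ∨ w ∈ g.anc (g.par v) := by
  simp [graft]

theorem graft_anc_newLeaf {u : TreeVertex} (hu : u ∈ newLeaves k n) :
    w ∈ (graft k n g v).anc u ↔ w = u ∨ w = node n ∨ w ∈ g.anc (g.par v) := by
  have : u ≠ node n := by rintro rfl; exact node_notMem_newLeaves hu
  simp [graft, this, hu]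

theorem graft_anc_old {u : TreeVertex} (hu : u ∈ verts k n ∨ u = root) :
    w ∈ (graft k n g v).anc u ↔ (w = node n ∧ v ∈ g.anc u) ∨ w ∈ g.anc u := by
  have h1 : u ≠ node n := by rintro rfl; simp [node_mem_verts] at hu
  have h2 : u ∉ newLeaves k n := by
    rcases hu with hu | rfl
    · exact notMem_newLeaves_of_mem_verts hu
    · simp [mem_newLeaves]
  simp only [graft, h1, h2, if_false]
  split_ifs with h3 <;> simp [h3]

theorem graft_owner_node : (graft k n g v).owner (node n) = g.owner v := by simp [graft]

theorem graft_owner_of_ne (hw : w ≠ node n) : (graft k n g v).owner w = g.owner w := by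
  simp [graft, hw]

theorem graft_par_node (hv : v ∈ verts k n) : (graft k n g v).par (node n) = g.par v := by
  have : node n ≠ v := by rintro rfl; exact node_notMem_verts hv
  simp [graft, this, node_notMem_newLeaves]

theorem graft_par_self : (graft k n g v).par v = node n := by simp [graft]

theorem graft_par_newLeaf (hw : w ∈ newLeaves k n) : (graft k n g v).par w = node n := by
  simp [graft, hw]

theorem graft_par_old (hw : w ∈ verts k n) (hwv : w ≠ v) : (graft k n g v).par w = g.par w := by
  have h1 : w ≠ node n := by rintro rfl; exact node_notMem_verts hw
  simp [graft, hwv, h1, notMem_newLeaves_of_mem_verts hw]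

end graft

theorem describes_init (k : ℕ) (c : ℕ → Sym2 TreeVertex) :
    init.Describes (verts k 0) (tree k c 0) := by
  rw [verts_zero]
  constructor <;> try simp [init]
  · simp only [tree, SimpleGraph.edgeSet_fromEdgeSet]
    ext e
    simp only [Set.mem_sdiff, mem_singleton_iff]
    constructor
    · exact fun h => h.1
    · rintro rfl
      exact ⟨rfl, by simp⟩

/-- The genealogy of the grafted graph. -/
theorem Describes.graft {k n : ℕ} {g : Genealogy} {G : SimpleGraph TreeVertex}
    (h : g.Describes (verts k n) G) {v : TreeVertex} (hv : v ∈ verts k n) :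
    (Genealogy.graft k n g v).Describes (verts k (n + 1))
      (TreeVertex.graft k n G s(g.par v, v)) := by
  have hνV : node n ∉ verts k n := node_notMem_verts
  have hp := h.par_mem v hv
  have hpV : ∀ w ∈ g.anc (g.par v), w ∈ verts k n := fun w hw => h.anc_subset hp hw
  have hancV : ∀ u, (u ∈ verts k n ∨ u = root) → node n ∉ g.anc u := fun u hu hw =>
    hνV (h.anc_subset hu hw)
  have howner : ∀ w ∈ verts k n, (Genealogy.graft k n g v).owner w = g.owner w := fun w hw =>
    graft_owner_of_ne (by rintro rfl; exact hνV hw)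
  have hleaf : ∀ w ∈ verts k n, g.owner w < (k - 1) * n + 1 := fun w hw =>
    leaf_mem_verts.1 (h.leaf_owner_mem w hw)
  have hnotMem : ∀ u ∈ verts k (n + 1),
      u ∉ (Genealogy.graft k n g v).anc ((Genealogy.graft k n g v).par u) := by
    intro u hu
    rcases mem_verts_succ.1 hu with rfl | hu | hu
    · rw [graft_par_node hv, graft_anc_old hp]
      rintro (⟨-, h1⟩ | h1)
      · exact h.notMem_anc_par v hv h1
      · exact hancV _ hp h1
    · rw [graft_par_newLeaf hu, graft_anc_node]
      rintro (rfl | h1)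
      · exact node_notMem_newLeaves hu
      · exact notMem_newLeaves_of_mem_verts (hpV _ h1) hu
    · by_cases huv : u = v
      · subst huv
        rw [graft_par_self, graft_anc_node]
        rintro (rfl | h1)
        · exact hνV hu
        · exact h.notMem_anc_par _ hu h1
      · rw [graft_par_old hu huv, graft_anc_old (h.par_mem u hu)]
        rintro (⟨rfl, -⟩ | h1)
        · exact hνV hu
        · exact h.notMem_anc_par _ hu h1
  have hmem : ∀ u ∈ verts k (n + 1), ∀ w, w ∈ (Genealogy.graft k n g v).anc u ↔
      w = u ∨ w ∈ (Genealogy.graft k n g v).anc ((Genealogy.graft k n g v).par u) := by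
    intro u hu w
    rcases mem_verts_succ.1 hu with rfl | hu | hu
    · have := h.notMem_anc_par v hv
      rw [graft_par_node hv, graft_anc_old hp, graft_anc_node]; tauto
    · rw [graft_par_newLeaf hu, graft_anc_node, graft_anc_newLeaf hu]
    · by_cases huv : u = v
      · subst huv
        have := h.self_mem_anc hu
        have h1 := h.mem_anc_iff u hu w
        rw [graft_par_self, graft_anc_node, graft_anc_old (Or.inl hu)]; tauto
      · have h1 := h.mem_anc_iff u hu w
        have h2 := h.mem_anc_iff u hu v
        have h3 : v ≠ u := fun h => huv h.symm
        rw [graft_par_old hu huv, graft_anc_old (h.par_mem u hu), graft_anc_old (Or.inl hu)]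
        tauto
  refine ⟨root_notMem_verts, ?_, ?_, hnotMem, hmem, ?_, ?_, ?_, ?_, ?_, ?_⟩
  · ext w
    rw [graft_anc_old (Or.inr rfl), h.anc_root]
    simp
  · intro u hu
    have hν' : node n ∈ verts k (n + 1) := mem_verts_succ.2 (Or.inl rfl)
    have hold : ∀ w, w ∈ verts k n ∨ w = root → w ∈ verts k (n + 1) ∨ w = root := by
      rintro w (hw | hw)
      · exact Or.inl (mem_verts_succ.2 (Or.inr (Or.inr hw)))
      · exact Or.inr hw
    rcases mem_verts_succ.1 hu with rfl | hu | hu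
    · rw [graft_par_node hv]; exact hold _ hp
    · rw [graft_par_newLeaf hu]; exact Or.inl hν'
    · by_cases huv : u = v
      · subst huv; rw [graft_par_self]; exact Or.inl hν'
      · rw [graft_par_old hu huv]; exact hold _ (h.par_mem u hu)
  · rw [TreeVertex.graft, SimpleGraph.edgeSet_fromEdgeSet]
    have hdiag : ∀ u ∈ verts k (n + 1), s((Genealogy.graft k n g v).par u, u) ∉ Sym2.diagSet := by
      intro u hu hd
      rw [Sym2.mem_diagSet, Sym2.mk_isDiag_iff] at hd
      exact hnotMem u hu (by rw [hd]; exact (hmem u hu u).2 (Or.inl rfl))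
    ext e
    simp only [Set.mem_sdiff, mem_union, mem_ofPred_eq, mem_singleton_iff, h.edgeSet_eq, mem_image,
      Finset.mem_coe]
    constructor
    · rintro ⟨(⟨⟨u, hu, rfl⟩, hne⟩ | ⟨x, hx, rfl⟩) | ⟨j, hj, rfl⟩, -⟩
      · have huv : u ≠ v := by rintro rfl; exact hne rfl
        exact ⟨u, mem_verts_succ.2 (Or.inr (Or.inr hu)), by rw [graft_par_old hu huv]⟩
      · rcases Sym2.mem_iff.1 hx with rfl | rfl
        · exact ⟨node n, mem_verts_succ.2 (Or.inl rfl), by rw [graft_par_node hv]⟩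
        · exact ⟨x, mem_verts_succ.2 (Or.inr (Or.inr hv)), by rw [graft_par_self, Sym2.eq_swap]⟩
      · have hj' : leaf j ∈ newLeaves k n := mem_newLeaves.2 ⟨j, hj, rfl⟩
        exact ⟨leaf j, mem_verts_succ.2 (Or.inr (Or.inl hj')), by rw [graft_par_newLeaf hj']⟩
    · rintro ⟨u, hu, rfl⟩
      refine ⟨?_, hdiag u hu⟩
      rcases mem_verts_succ.1 hu with rfl | hu | hu
      · rw [graft_par_node hv]
        exact Or.inl (Or.inr ⟨g.par v, by simp, rfl⟩)
      · rw [graft_par_newLeaf hu]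
        obtain ⟨j, hj, rfl⟩ := mem_newLeaves.1 hu
        exact Or.inr ⟨j, hj, rfl⟩
      · by_cases huv : u = v
        · subst huv
          rw [graft_par_self]
          exact Or.inl (Or.inr ⟨u, by simp, Sym2.eq_swap⟩)
        · rw [graft_par_old hu huv]
          exact Or.inl (Or.inl ⟨⟨u, hu, rfl⟩, fun he => huv (h.edge_injOn hu hv he)⟩)
  · intro u hu w hw
    rcases mem_verts_succ.1 hu with rfl | hu | hu
    · rw [graft_owner_node]
      rcases graft_anc_node.1 hw with rfl | hw
      · rw [graft_owner_node]
      · rw [howner w (hpV w hw)]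
        exact h.owner_le v hv w ((h.mem_anc_iff v hv w).2 (Or.inr hw))
    · obtain ⟨j, hj, rfl⟩ := mem_newLeaves.1 hu
      rw [graft_owner_of_ne (by simp : leaf j ≠ node n), h.owner_leaf]
      rcases (graft_anc_newLeaf hu).1 hw with rfl | rfl | hw
      · rw [graft_owner_of_ne (by simp : leaf j ≠ node n), h.owner_leaf]
      · rw [graft_owner_node]; have := hleaf v hv; omega
      · rw [howner w (hpV w hw)]; have := hleaf w (hpV w hw); omega
    · rw [howner u hu]
      rcases (graft_anc_old (Or.inl hu)).1 hw with ⟨rfl, hw'⟩ | hw'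
      · rw [graft_owner_node]; exact h.owner_le u hu v hw'
      · rw [howner w (h.anc_subset (Or.inl hu) hw')]; exact h.owner_le u hu w hw'
  · intro u hu
    rcases mem_verts_succ.1 hu with rfl | hu | hu
    · rw [graft_owner_node]; exact mem_verts_succ.2 (Or.inr (Or.inr (h.leaf_owner_mem v hv)))
    · obtain ⟨j, hj, rfl⟩ := mem_newLeaves.1 hu
      rw [graft_owner_of_ne (by simp : leaf j ≠ node n), h.owner_leaf]
      exact mem_verts_succ.2 (Or.inr (Or.inl hu))
    · rw [howner u hu]; exact mem_verts_succ.2 (Or.inr (Or.inr (h.leaf_owner_mem u hu)))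
  · intro u hu
    rcases mem_verts_succ.1 hu with rfl | hu | hu
    · rw [graft_owner_node, graft_anc_old (Or.inl (h.leaf_owner_mem v hv))]
      exact Or.inl ⟨rfl, h.mem_anc_leaf_owner v hv⟩
    · obtain ⟨j, hj, rfl⟩ := mem_newLeaves.1 hu
      rw [graft_owner_of_ne (by simp : leaf j ≠ node n), h.owner_leaf, graft_anc_newLeaf hu]
      exact Or.inl rfl
    · rw [howner u hu, graft_anc_old (Or.inl (h.leaf_owner_mem u hu))]
      exact Or.inr (h.mem_anc_leaf_owner u hu)
  · intro j
    rw [graft_owner_of_ne (by simp : leaf j ≠ node n), h.owner_leaf]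
  · intro u hu j hj
    rcases mem_verts_succ.1 hu with rfl | hu | hu
    · rcases graft_anc_node.1 hj with hj | hj
      · cases hj
      · exfalso
        have h1 := h.eq_leaf_of_mem_anc v hv j ((h.mem_anc_iff v hv _).2 (Or.inr hj))
        exact h.notMem_anc_par v hv (h1 ▸ hj)
    · rcases (graft_anc_newLeaf hu).1 hj with hj | hj | hj
      · exact hj.symm
      · cases hj
      · exfalso
        have h1 := h.eq_leaf_of_mem_anc v hv j ((h.mem_anc_iff v hv _).2 (Or.inr hj))
        exact h.notMem_anc_par v hv (h1 ▸ hj)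
    · rcases (graft_anc_old (Or.inl hu)).1 hj with ⟨hj, -⟩ | hj
      · cases hj
      · exact h.eq_leaf_of_mem_anc u hu j hj

open Classical in
/-- The lower end of the edge `e` (and the root, if `e` is not an edge). -/
noncomputable def child (g : Genealogy) (V : Finset TreeVertex) (e : Sym2 TreeVertex) :
    TreeVertex :=
  if h : ∃ v ∈ V, s(g.par v, v) = e then h.choose else root

theorem Describes.child_edge {g : Genealogy} {V : Finset TreeVertex} {G : SimpleGraph TreeVertex}
    (h : g.Describes V G) {v : TreeVertex} (hv : v ∈ V) : g.child V s(g.par v, v) = v := by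
  have hex : ∃ u ∈ V, s(g.par u, u) = s(g.par v, v) := ⟨v, hv, rfl⟩
  rw [child, dif_pos hex]
  exact h.edge_injOn hex.choose_spec.1 hv hex.choose_spec.2

end Genealogy

open Genealogy

/-- The genealogy of `T_n` when the edges `c 0, c 1, …` are selected. -/
noncomputable def genealogy (k : ℕ) (c : ℕ → Sym2 TreeVertex) : ℕ → Genealogy
  | 0 => Genealogy.init
  | n + 1 => (genealogy k c n).graft k n ((genealogy k c n).child (verts k n) (c n))

/-- The first `n` selected edges are edges of the trees that have to be split. -/
def IsAdmissible (k : ℕ) (c : ℕ → Sym2 TreeVertex) (n : ℕ) : Prop :=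
  ∀ i < n, c i ∈ (tree k c i).edgeSet

theorem describes_genealogy {k n : ℕ} {c : ℕ → Sym2 TreeVertex} (hc : IsAdmissible k c n) :
    (genealogy k c n).Describes (verts k n) (tree k c n) := by
  induction n with
  | zero => exact describes_init k c
  | succ n ih =>
    have h := ih fun i hi => hc i (hi.trans n.lt_succ_self)
    have he := hc n n.lt_succ_self
    rw [h.edgeSet_eq] at he
    obtain ⟨v, hv, he⟩ := he
    rw [genealogy, tree, ← he, h.child_edge hv]
    exact h.graft hv

theorem tree_congr {k n : ℕ} {c c' : ℕ → Sym2 TreeVertex} (h : ∀ i < n, c i = c' i) :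
    tree k c n = tree k c' n := by
  induction n with
  | zero => rfl
  | succ n ih => rw [tree, tree, ih fun i hi => h i (hi.trans n.lt_succ_self), h n n.lt_succ_self]

theorem genealogy_congr {k n : ℕ} {c c' : ℕ → Sym2 TreeVertex} (h : ∀ i < n, c i = c' i) :
    genealogy k c n = genealogy k c' n := by
  induction n with
  | zero => rfl
  | succ n ih =>
    rw [genealogy, genealogy, ih fun i hi => h i (hi.trans n.lt_succ_self), h n n.lt_succ_self]

end TreeVertex

/-- Isometries on a set that contains the tree map spanned subtrees to spanned subtrees. -/
theorem image_treeSpan {M N : Type*} [MetricSpace M] [MetricSpace N] {φ : M → N} {A S B : Set M}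
    (hA : A ⊆ B) (hS : S ⊆ B) (hφ : ∀ x ∈ B, ∀ y ∈ B, dist (φ x) (φ y) = dist x y) :
    φ '' treeSpan A S = treeSpan (φ '' A) (φ '' S) := by
  ext z
  constructor
  · rintro ⟨z, ⟨hz, x, hx, y, hy, h⟩, rfl⟩
    refine ⟨⟨z, hz, rfl⟩, _, ⟨x, hx, rfl⟩, _, ⟨y, hy, rfl⟩, ?_⟩
    rw [hφ x (hS hx) z (hA hz), hφ z (hA hz) y (hS hy), hφ x (hS hx) y (hS hy), h]
  · rintro ⟨⟨z, hz, rfl⟩, _, ⟨x, hx, rfl⟩, _, ⟨y, hy, rfl⟩, h⟩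
    rw [hφ x (hS hx) z (hA hz), hφ z (hA hz) y (hS hy), hφ x (hS hx) y (hS hy)] at h
    exact ⟨z, ⟨hz, x, hx, y, hy, h⟩, rfl⟩

namespace TreeVertex

/-! ### Sticks of the discrete trees -/

namespace Genealogy

open Classical in
/-- The part of the `q`-th stick that lies above the vertex `u`. -/
noncomputable def stickAbove (g : Genealogy) (V : Finset TreeVertex) (u : TreeVertex) (q : ℕ) :
    Finset TreeVertex :=
  V.filter fun w => w ∈ g.anc u ∧ g.owner w = q

open Classical in
/-- The part of the `q`-th stick that does not lie above the vertex `u`. -/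
noncomputable def stickBeyond (g : Genealogy) (V : Finset TreeVertex) (u : TreeVertex) (q : ℕ) :
    Finset TreeVertex :=
  V.filter fun w => w ∉ g.anc u ∧ g.owner w = q

/-- The linear map that sends the unit vector of a vertex to the unit vector of its stick. -/
noncomputable def collapse (g : Genealogy) (V : Finset TreeVertex) : EdgeSpace →ₗ[ℝ] EllOne :=
  ∑ w ∈ V, (lp.evalₗ (𝕜 := ℝ) (fun _ : TreeVertex => ℝ) 1 w).smulRight (unitVec (g.owner w))

/-- The end of the `i`-th stick of the tree `G`, folded into `ℓ¹`. -/
noncomputable def stickEnd (g : Genealogy) (V : Finset TreeVertex) (G : SimpleGraph TreeVertex)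
    (i : ℕ) : EllOne :=
  g.collapse V (position G (leaf i))

/-- The beginning of the `i`-th stick of the tree `G`, folded into `ℓ¹`. -/
noncomputable def stickStart (g : Genealogy) (V : Finset TreeVertex) (G : SimpleGraph TreeVertex)
    (i : ℕ) : EllOne :=
  g.stickEnd V G i + (-(g.stickAbove V (leaf i) i).card : ℝ) • unitVec i

theorem mem_stickAbove {g : Genealogy} {V : Finset TreeVertex} {u w : TreeVertex} {q : ℕ} :
    w ∈ g.stickAbove V u q ↔ w ∈ V ∧ w ∈ g.anc u ∧ g.owner w = q := by
  simp [stickAbove]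

theorem mem_stickBeyond {g : Genealogy} {V : Finset TreeVertex} {u w : TreeVertex} {q : ℕ} :
    w ∈ g.stickBeyond V u q ↔ w ∈ V ∧ w ∉ g.anc u ∧ g.owner w = q := by
  simp [stickBeyond]

open Classical in
theorem collapse_apply (g : Genealogy) (V : Finset TreeVertex) (x : EdgeSpace) (q : ℕ) :
    g.collapse V x q = ∑ w ∈ V with g.owner w = q, x w := by
  rw [collapse, LinearMap.sum_apply, lp.coeFn_sum, Finset.sum_apply, Finset.sum_filter]
  refine Finset.sum_congr rfl fun w _ => ?_
  change x w * unitVec (g.owner w) q = _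
  rw [lp.single_apply]
  split_ifs with h
  · subst h; simp
  · rw [Pi.single_eq_of_ne (Ne.symm h), mul_zero]

theorem collapse_single (g : Genealogy) {V : Finset TreeVertex} {v : TreeVertex} (hv : v ∈ V)
    [DecidableEq TreeVertex] : g.collapse V (lp.single 1 v (1 : ℝ)) = unitVec (g.owner v) := by
  classical
  ext q
  rw [collapse_apply, Finset.sum_filter, lp.single_apply]
  rw [Finset.sum_eq_single v]
  · rw [lp.single_apply_self]
    split_ifs with h
    · subst h; simp
    · rw [Pi.single_eq_of_ne (Ne.symm h)]
  · intro w _ hwv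
    rw [lp.single_apply_ne _ _ _ hwv, ite_self]
  · exact fun h => absurd hv h

/-- The points of `ℓ¹` that are filled along each path from the root, starting from the root. Such
are the points of the realization of the tree. -/
def IsTreePoint (g : Genealogy) (V : Finset TreeVertex) (x : EdgeSpace) : Prop :=
  (∀ w, w ∉ V → x w = 0) ∧ (∀ w, 0 ≤ x w ∧ x w ≤ 1) ∧
    ∀ w' ∈ V, ∀ w ∈ g.anc w', w ≠ w' → x w < 1 → x w' = 0

namespace Describes

variable {g : Genealogy} {V : Finset TreeVertex} {G : SimpleGraph TreeVertex}

/-- Folding is isometric on the tree: on a stick, the difference of two points of the tree has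
constant sign, so that no cancellation occurs. -/
theorem dist_collapse (h : g.Describes V G) {x y : EdgeSpace} (hx : g.IsTreePoint V x)
    (hy : g.IsTreePoint V y) : dist (g.collapse V x) (g.collapse V y) = dist x y := by
  classical
  have aux : ∀ x y : EdgeSpace, g.IsTreePoint V x → g.IsTreePoint V y → ∀ w ∈ V, ∀ w' ∈ V,
      w ∈ g.anc w' → y w < x w → y w' ≤ x w' := by
    intro x y hx hy w hw w' hw' hww hlt
    by_cases he : w = w'
    · subst he; exact hlt.le
    · rw [hy.2.2 w' hw' w hww he (hlt.trans_le (hx.2.1 w).2)]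
      exact (hx.2.1 w').1
  have sign : ∀ x y : EdgeSpace, g.IsTreePoint V x → g.IsTreePoint V y → ∀ w ∈ V, ∀ w' ∈ V,
      g.owner w = g.owner w' → y w < x w → y w' ≤ x w' := by
    intro x y hx hy w hw w' hw' ho hlt
    have h1 := h.mem_anc_leaf_owner w hw
    rw [ho] at h1
    rcases h.anc_total (Or.inl (h.leaf_owner_mem w' hw')) h1 (h.mem_anc_leaf_owner w' hw')
      with h2 | h2
    · exact aux x y hx hy w hw w' hw' h2 hlt
    · by_contra hcon
      exact absurd (aux y x hy hx w' hw' w hw h2 (not_le.1 hcon)) (not_le.2 hlt)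
  rw [dist_eq_norm, dist_eq_norm, ← map_sub]
  refine (lp_one_hasSum_norm (g.collapse V (x - y))).unique ?_
  have hfib : ∀ q, |g.collapse V (x - y) q| = ∑ w ∈ V with g.owner w = q, |(x - y) w| := by
    intro q
    rw [collapse_apply]
    by_cases hpos : ∃ w ∈ V, g.owner w = q ∧ y w < x w
    · obtain ⟨w, hw, ho, hlt⟩ := hpos
      have hle : ∀ w ∈ V.filter (fun w => g.owner w = q), 0 ≤ (x - y) w := by
        intro w' hw'
        rw [Finset.mem_filter] at hw'
        have h1 : 0 ≤ x w' - y w' :=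
          sub_nonneg.2 (sign x y hx hy w hw w' hw'.1 (ho.trans hw'.2.symm) hlt)
        exact h1
      rw [Finset.abs_sum_of_nonneg hle]
      exact Finset.sum_congr rfl fun w hw => (abs_of_nonneg (hle w hw)).symm
    · push Not at hpos
      have hle : ∀ w ∈ V.filter (fun w => g.owner w = q), (x - y) w ≤ 0 := by
        intro w hw
        rw [Finset.mem_filter] at hw
        have h1 : x w - y w ≤ 0 := sub_nonpos.2 (hpos w hw.1 hw.2)
        exact h1
      rw [← abs_neg, ← Finset.sum_neg_distrib,
        Finset.abs_sum_of_nonneg fun w hw => neg_nonneg.2 (hle w hw)]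
      exact Finset.sum_congr rfl fun w hw => (abs_of_nonpos (hle w hw)).symm
  have hnorm : ‖x - y‖ = ∑ w ∈ V, |(x - y) w| := by
    refine (lp_one_hasSum_norm (x - y)).unique (hasSum_sum_of_ne_finset_zero fun w hw => ?_)
    change |x w - y w| = 0
    rw [hx.1 w hw, hy.1 w hw, sub_zero, abs_zero]
  have hV : ∑ w ∈ V, |(x - y) w| =
      ∑ q ∈ V.image g.owner, |g.collapse V (x - y) q| := by
    rw [Finset.sum_congr rfl fun q _ => hfib q]
    exact (Finset.sum_fiberwise_of_maps_to (fun w hw => Finset.mem_image_of_mem _ hw) _).symm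
  rw [hnorm, hV]
  refine hasSum_sum_of_ne_finset_zero fun q hq => ?_
  rw [hfib q, Finset.sum_eq_zero]
  intro w hw
  rw [Finset.mem_filter] at hw
  exact absurd (hw.2 ▸ Finset.mem_image_of_mem _ hw.1) hq

theorem isTreePoint_position (h : g.Describes V G) {v : TreeVertex} (hv : v ∈ V ∨ v = root) :
    g.IsTreePoint V (position G v) := by
  classical
  refine ⟨fun w hw => ?_, fun w => ?_, fun w' hw' w hw hne hlt => ?_⟩
  · rw [h.position_apply hv, if_neg fun h1 => hw (h.anc_subset hv h1)]
  · rw [h.position_apply hv]; split_ifs <;> simp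
  · rw [h.position_apply hv] at hlt ⊢
    rw [if_neg]
    intro h1
    rw [if_pos (h.anc_trans hv h1 hw)] at hlt
    exact lt_irrefl _ hlt

theorem isTreePoint_of_mem_realization (h : g.Describes V G) {z : EdgeSpace}
    (hz : z ∈ realization G) : g.IsTreePoint V z := by
  classical
  obtain ⟨v, hv, t, ht, rfl⟩ := h.mem_realization_iff.1 hz
  have happ : ∀ w, (position G (g.par v) + t • lp.single 1 v (1 : ℝ) : EdgeSpace) w =
      if w ∈ g.anc (g.par v) then 1 else if w = v then t else 0 := by
    intro w
    change position G (g.par v) w + t * (lp.single 1 v (1 : ℝ) : EdgeSpace) w = _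
    rw [h.position_apply (h.par_mem v hv), lp.single_apply, Pi.single_apply]
    have := h.notMem_anc_par v hv
    split_ifs with h1 h2 <;> simp_all
  refine ⟨fun w hw => ?_, fun w => ?_, fun w' hw' w hw hne hlt => ?_⟩
  · rw [happ, if_neg fun h1 => hw (h.anc_subset (h.par_mem v hv) h1), if_neg]
    rintro rfl; exact hw hv
  · rw [happ]; split_ifs <;> simp [ht.1, ht.2]
  · rw [happ] at hlt ⊢
    have hnot : w ∉ g.anc (g.par v) := fun h1 => by simp [h1] at hlt
    rw [if_neg, if_neg]
    · rintro rfl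
      rcases (h.mem_anc_iff w' hv w).1 hw with h1 | h1
      · exact hne h1
      · exact hnot h1
    · exact fun h1 => hnot (h.anc_trans (h.par_mem v hv) h1 hw)

theorem collapse_position_apply (h : g.Describes V G) {v : TreeVertex} (hv : v ∈ V ∨ v = root)
    (q : ℕ) : g.collapse V (position G v) q = (g.stickAbove V v q).card := by
  classical
  rw [collapse_apply, Finset.sum_congr rfl fun w _ => h.position_apply hv w, ← Finset.sum_filter,
    Finset.sum_const, nsmul_eq_mul, mul_one, Finset.filter_filter, stickAbove]
  congr 2
  ext w
  simp [and_comm]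

theorem stickEnd_apply (h : g.Describes V G) {i : ℕ} (hi : leaf i ∈ V) (q : ℕ) :
    g.stickEnd V G i q = (g.stickAbove V (leaf i) q).card :=
  h.collapse_position_apply (Or.inl hi) q

/-- A vertex of the `j`-th stick and the `j`-th leaf are below the same parts of the other
sticks. -/
theorem stickAbove_eq_of_owner (h : g.Describes V G) {u : TreeVertex} (hu : u ∈ V) {q : ℕ}
    (hq : q ≠ g.owner u) : g.stickAbove V u q = g.stickAbove V (leaf (g.owner u)) q := by
  have hl := h.leaf_owner_mem u hu
  have hul := h.mem_anc_leaf_owner u hu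
  ext w
  rw [mem_stickAbove, mem_stickAbove]
  refine and_congr_right fun hw => and_congr_left fun ho => ?_
  constructor
  · exact fun h1 => h.anc_trans (Or.inl hl) hul h1
  · intro h1
    rcases h.anc_total (Or.inl hl) h1 hul with h2 | h2
    · exact h2
    · exfalso
      have h3 := h.owner_le _ hl w h1
      rw [h.owner_leaf] at h3
      exact hq (ho ▸ le_antisymm h3 (h.owner_le w hw u h2))

theorem stickAbove_subset_of_owner (h : g.Describes V G) {u : TreeVertex} (hu : u ∈ V) (q : ℕ) :
    g.stickAbove V u q ⊆ g.stickAbove V (leaf (g.owner u)) q := by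
  intro w hw
  rw [mem_stickAbove] at hw ⊢
  exact ⟨hw.1, h.anc_trans (Or.inl (h.leaf_owner_mem u hu)) (h.mem_anc_leaf_owner u hu) hw.2.1,
    hw.2.2⟩

theorem collapse_position (h : g.Describes V G) {u : TreeVertex} (hu : u ∈ V) :
    g.collapse V (position G u) = g.stickStart V G (g.owner u) +
      ((g.stickAbove V u (g.owner u)).card : ℝ) • unitVec (g.owner u) := by
  ext q
  rw [h.collapse_position_apply (Or.inl hu)]
  by_cases hq : q = g.owner u
  · subst hq
    rw [add_smul_unitVec_apply_self, stickStart, add_smul_unitVec_apply_self,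
      h.stickEnd_apply (h.leaf_owner_mem u hu)]
    ring
  · rw [add_smul_unitVec_apply_ne _ _ hq, stickStart, add_smul_unitVec_apply_ne _ _ hq,
      h.stickEnd_apply (h.leaf_owner_mem u hu), h.stickAbove_eq_of_owner hu hq]

theorem stickEnd_eq (i : ℕ) : g.stickEnd V G i =
    g.stickStart V G i + ((g.stickAbove V (leaf i) i).card : ℝ) • unitVec i := by
  rw [stickStart, add_assoc, ← add_smul, neg_add_cancel, zero_smul, add_zero]

theorem stickAbove_leaf_self_pos (h : g.Describes V G) {i : ℕ} (hi : leaf i ∈ V) :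
    0 < (g.stickAbove V (leaf i) i).card :=
  Finset.card_pos.2 ⟨leaf i, mem_stickAbove.2 ⟨hi, h.self_mem_anc hi, h.owner_leaf i⟩⟩

theorem stickBeyond_leaf_pos (h : g.Describes V G) {i j : ℕ} (hi : leaf i ∈ V) (hj : leaf j ∈ V)
    (hij : i ≠ j) : 0 < (g.stickBeyond V (leaf i) j).card := by
  refine Finset.card_pos.2 ⟨leaf j, mem_stickBeyond.2 ⟨hj, fun h1 => hij ?_, h.owner_leaf j⟩⟩
  simpa using h.eq_leaf_of_mem_anc _ hi j h1

/-- The `j`-th stick is the union of its parts above and beyond another leaf. -/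
theorem card_stickAbove_add_card_stickBeyond (h : g.Describes V G) {i j : ℕ} :
    (g.stickAbove V (leaf i) j).card + (g.stickBeyond V (leaf i) j).card =
      (g.stickAbove V (leaf j) j).card := by
  classical
  rw [← Finset.card_union_of_disjoint]
  · congr 1
    ext w
    rw [Finset.mem_union, mem_stickAbove, mem_stickBeyond, mem_stickAbove]
    constructor
    · rintro (⟨h1, -, rfl⟩ | ⟨h1, -, rfl⟩) <;> exact ⟨h1, h.mem_anc_leaf_owner w h1, rfl⟩
    · tauto
  · rw [Finset.disjoint_left]
    intro w h1 h2
    exact (mem_stickBeyond.1 h2).2.1 (mem_stickAbove.1 h1).2.1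

/-- The position of a vertex whose ancestors are those of the `i`-th leaf outside of the `i`-th
stick is the beginning of the `i`-th stick. -/
theorem stickStart_eq_collapse (h : g.Describes V G) {i : ℕ} (hi : leaf i ∈ V) {u : TreeVertex}
    (hu : u ∈ V) (hanc : ∀ w, w ∈ g.anc u ↔ w ∈ g.anc (leaf i) ∧ g.owner w ≠ i) :
    g.stickStart V G i = g.collapse V (position G u) := by
  ext q
  rw [h.collapse_position_apply (Or.inl hu), stickStart]
  by_cases hq : q = i
  · subst hq
    rw [add_smul_unitVec_apply_self, h.stickEnd_apply hi, add_neg_cancel]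
    rw [eq_comm, Nat.cast_eq_zero, Finset.card_eq_zero, Finset.eq_empty_iff_forall_notMem]
    intro w hw
    rw [mem_stickAbove, hanc] at hw
    exact hw.2.1.2 hw.2.2
  · rw [add_smul_unitVec_apply_ne _ _ hq, h.stickEnd_apply hi]
    congr 2
    ext w
    rw [mem_stickAbove, mem_stickAbove, hanc]
    constructor
    · rintro ⟨h1, h2, rfl⟩; exact ⟨h1, ⟨h2, hq⟩, rfl⟩
    · tauto

theorem mem_segment_of_owner (h : g.Describes V G) {u : TreeVertex} (hu : u ∈ V) :
    g.collapse V (position G u) ∈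
      segment ℝ (g.stickStart V G (g.owner u)) (g.stickEnd V G (g.owner u)) := by
  rw [stickEnd_eq, segment_add_smul_unitVec _ _ (Nat.cast_nonneg _), h.collapse_position hu]
  exact ⟨_, ⟨Nat.cast_nonneg _, by
    exact_mod_cast Finset.card_le_card (h.stickAbove_subset_of_owner hu _)⟩, rfl⟩

/-- All the points of a stick above one of its vertices come from points of the tree. -/
theorem mem_image_realization (h : g.Describes V G) {v : TreeVertex} (hv : v ∈ V) :
    ∀ s ∈ Icc (0 : ℝ) (g.stickAbove V v (g.owner v)).card,
      g.stickStart V G (g.owner v) + s • unitVec (g.owner v) ∈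
        g.collapse V '' realization G := by
  classical
  refine h.induction (P := fun v => v ∈ V → ∀ s ∈ Icc (0 : ℝ) (g.stickAbove V v (g.owner v)).card,
      g.stickStart V G (g.owner v) + s • unitVec (g.owner v) ∈ g.collapse V '' realization G)
    (fun h1 => absurd h1 h.root_notMem) (fun v hv hpar ih _ s hs => ?_) (Or.inl hv) hv
  rcases le_or_gt ((g.stickAbove V v (g.owner v)).card - 1 : ℝ) s with h1 | h1
  · refine ⟨position G (g.par v) + (s - ((g.stickAbove V v (g.owner v)).card - 1)) •
      lp.single 1 v (1 : ℝ), h.mem_realization_iff.2 ⟨v, hv, _, ⟨by linarith, by linarith [hs.2]⟩,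
        rfl⟩, ?_⟩
    have h2 := h.collapse_position hv
    rw [h.position_eq_add hv, map_add, collapse_single g hv] at h2
    rw [map_add, map_smul, collapse_single g hv, eq_sub_of_add_eq h2]
    module
  · -- the stick has another vertex above `v`, hence the parent of `v` is on the stick
    have h2 : 1 < (g.stickAbove V v (g.owner v)).card := by
      have : (1 : ℝ) < (g.stickAbove V v (g.owner v)).card := by linarith [hs.1]
      exact_mod_cast this
    obtain ⟨w, hw, hwv⟩ := Finset.exists_mem_ne h2 v
    obtain ⟨hwV, hwv', hwo⟩ := mem_stickAbove.1 hw
    have hwp := ((h.mem_anc_iff v hv w).1 hwv').resolve_left hwv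
    have hpV : g.par v ∈ V := by
      rcases hpar with h3 | h3
      · exact h3
      · rw [h3, h.anc_root] at hwp; simp at hwp
    have ho : g.owner (g.par v) = g.owner v := by
      refine le_antisymm (h.owner_le v hv _ ((h.mem_anc_iff v hv _).2
        (Or.inr (h.self_mem_anc hpV)))) ?_
      rw [← hwo]
      exact h.owner_le _ hpV w hwp
    have hcard : (g.stickAbove V v (g.owner v)).card =
        (g.stickAbove V (g.par v) (g.owner v)).card + 1 := by
      rw [← Finset.card_insert_of_notMem (a := v)]
      · congr 1
        ext w
        rw [Finset.mem_insert, mem_stickAbove, mem_stickAbove, h.mem_anc_iff v hv w]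
        constructor
        · tauto
        · rintro (rfl | h3)
          · exact ⟨hv, Or.inl rfl, rfl⟩
          · tauto
      · rw [mem_stickAbove]
        exact fun h3 => h.notMem_anc_par v hv h3.2.1
    have := ih hpV s
    rw [ho] at this
    refine this ⟨hs.1, ?_⟩
    rw [hcard] at h1
    push_cast at h1
    linarith

/-- Folding turns the realization of the tree into the union of its sticks. -/
theorem image_realization (h : g.Describes V G) {m : ℕ} (hm : ∀ j, leaf j ∈ V ↔ j < m) :
    g.collapse V '' realization G = stickTree (g.stickStart V G) (g.stickEnd V G) m := by
  classical
  ext z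
  constructor
  · rintro ⟨z, hz, rfl⟩
    obtain ⟨v, hv, t, ht, rfl⟩ := h.mem_realization_iff.1 hz
    refine ⟨g.owner v, (hm _).1 (h.leaf_owner_mem v hv), ?_⟩
    rw [stickEnd_eq, segment_add_smul_unitVec _ _ (Nat.cast_nonneg _)]
    have h1 : 1 ≤ (g.stickAbove V v (g.owner v)).card :=
      Finset.card_pos.2 ⟨v, mem_stickAbove.2 ⟨hv, h.self_mem_anc hv, rfl⟩⟩
    have h2 := Finset.card_le_card (h.stickAbove_subset_of_owner hv (g.owner v))
    have h1' : (1 : ℝ) ≤ (g.stickAbove V v (g.owner v)).card := by exact_mod_cast h1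
    have h2' : ((g.stickAbove V v (g.owner v)).card : ℝ) ≤
      (g.stickAbove V (leaf (g.owner v)) (g.owner v)).card := by exact_mod_cast h2
    refine ⟨(g.stickAbove V v (g.owner v)).card - 1 + t,
      ⟨by linarith [ht.1], by linarith [ht.2]⟩, ?_⟩
    have h3 := h.collapse_position hv
    rw [h.position_eq_add hv, map_add, collapse_single g hv] at h3
    rw [map_add, map_smul, collapse_single g hv, eq_sub_of_add_eq h3]
    module
  · rintro ⟨i, hi, hz⟩
    rw [stickEnd_eq, segment_add_smul_unitVec _ _ (Nat.cast_nonneg _)] at hz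
    obtain ⟨s, hs, rfl⟩ := hz
    have := h.mem_image_realization ((hm i).2 hi) s
    rw [h.owner_leaf] at this
    exact this hs

/-- Folding turns the subtree spanned by the first leaves into the union of the first sticks. -/
theorem image_marginal (h : g.Describes V G) {m k p : ℕ} (hm : ∀ j, leaf j ∈ V ↔ j < m)
    (hsb : IsStickBreakingUpTo m (g.stickStart V G) (g.stickEnd V G)) (hp : (k - 1) * p + 1 ≤ m) :
    g.collapse V '' marginal k p G =
      stickTree (g.stickStart V G) (g.stickEnd V G) ((k - 1) * p + 1) := by
  rw [marginal, image_treeSpan (B := {x | g.IsTreePoint V x}), h.image_realization hm,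
    hsb.stickTree_eq_treeSpan (Nat.succ_pos _) hp]
  · congr 1
    ext z
    simp only [mem_image, mem_union, mem_singleton_iff, mem_ofPred_eq, h.position_root]
    constructor
    · rintro ⟨x, rfl | ⟨i, hi, rfl⟩, rfl⟩
      · left; simp
      · exact Or.inr ⟨i, hi, rfl⟩
    · rintro (rfl | ⟨i, hi, rfl⟩)
      · exact ⟨0, Or.inl rfl, map_zero _⟩
      · exact ⟨_, Or.inr ⟨i, hi, rfl⟩, rfl⟩
  · exact fun z hz => h.isTreePoint_of_mem_realization hz
  · rintro x (rfl | ⟨i, hi, rfl⟩)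
    · exact h.isTreePoint_position (Or.inr rfl)
    · exact h.isTreePoint_position (Or.inl ((hm i).2 (hi.trans_le hp)))
  · exact fun x hx y hy => h.dist_collapse hx hy

theorem isTreePoint_of_mem_marginal (h : g.Describes V G) {k p : ℕ} {z : EdgeSpace}
    (hz : z ∈ marginal k p G) : g.IsTreePoint V z :=
  h.isTreePoint_of_mem_realization hz.1

theorem dist_leaf_leaf (h : g.Describes V G) {i j : ℕ} (hi : leaf i ∈ V) (hj : leaf j ∈ V) :
    (G.dist (leaf i) (leaf j) : ℝ) = dist (g.stickEnd V G i) (g.stickEnd V G j) := by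
  rw [h.dist_eq_dist_position (Or.inl hi) (Or.inl hj), stickEnd, stickEnd,
    h.dist_collapse (h.isTreePoint_position (Or.inl hi)) (h.isTreePoint_position (Or.inl hj))]

theorem dist_root_leaf (h : g.Describes V G) {i : ℕ} (hi : leaf i ∈ V) :
    (G.dist root (leaf i) : ℝ) = dist 0 (g.stickEnd V G i) := by
  rw [h.dist_eq_dist_position (Or.inr rfl) (Or.inl hi), stickEnd,
    ← h.dist_collapse (h.isTreePoint_position (Or.inr rfl)) (h.isTreePoint_position (Or.inl hi)),
    h.position_root, map_zero]

end Describes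

end Genealogy

end TreeVertex

namespace TreeVertex

/-! ### Evolution of the sticks -/

namespace Genealogy

variable {k n : ℕ} {g : Genealogy} {G : SimpleGraph TreeVertex} {v : TreeVertex}

theorem Describes.mem_stickAbove_graft (h : g.Describes (verts k n) G) (hv : v ∈ verts k n)
    {u : TreeVertex} (hu : u ∈ verts k n) (q : ℕ) (w : TreeVertex) :
    w ∈ (Genealogy.graft k n g v).stickAbove (verts k (n + 1)) u q ↔
      (w = node n ∧ v ∈ g.stickAbove (verts k n) u q) ∨ w ∈ g.stickAbove (verts k n) u q := by
  rw [mem_stickAbove, mem_stickAbove, mem_stickAbove, graft_anc_old (Or.inl hu)]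
  by_cases hw : w = node n
  · subst hw
    have h1 : node n ∉ g.anc u := fun h1 => node_notMem_verts (h.anc_subset (Or.inl hu) h1)
    rw [graft_owner_node]
    simp [mem_verts_succ, node_notMem_verts, hv, h1]
  · have h1 : w ∈ g.anc u → w ∈ verts k n := fun h1 => h.anc_subset (Or.inl hu) h1
    rw [graft_owner_of_ne hw, mem_verts_succ]
    tauto

theorem Describes.mem_stickBeyond_graft (h : g.Describes (verts k n) G) (hv : v ∈ verts k n)
    {u : TreeVertex} (hu : u ∈ verts k n) {q : ℕ} (hq : leaf q ∈ verts k n) (w : TreeVertex) :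
    w ∈ (Genealogy.graft k n g v).stickBeyond (verts k (n + 1)) u q ↔
      (w = node n ∧ v ∈ g.stickBeyond (verts k n) u q) ∨ w ∈ g.stickBeyond (verts k n) u q := by
  rw [mem_stickBeyond, mem_stickBeyond, mem_stickBeyond, graft_anc_old (Or.inl hu)]
  by_cases hw : w = node n
  · subst hw
    have h1 : node n ∉ g.anc u := fun h1 => node_notMem_verts (h.anc_subset (Or.inl hu) h1)
    rw [graft_owner_node]
    simp [mem_verts_succ, node_notMem_verts, hv, h1]
  · have h1 : w ∈ newLeaves k n → g.owner w ≠ q := by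
      rintro h1 rfl
      obtain ⟨j, -, rfl⟩ := mem_newLeaves.1 h1
      rw [h.owner_leaf] at hq
      exact notMem_newLeaves_of_mem_verts hq h1
    rw [graft_owner_of_ne hw, mem_verts_succ]
    tauto

end Genealogy

/-- A family of sets of vertices of the growing trees, depending only on the past choices, whose size
changes from the time `n₀` on only when an edge above one of its elements is split, and then grows
by one. -/
structure IsSplittingFamily (k n₀ : ℕ) (S : ℕ → (ℕ → Sym2 TreeVertex) → Finset TreeVertex) :
    Prop where
  subset : ∀ n c, S n c ⊆ verts k n
  congr : ∀ n c c', (∀ i < n, c i = c' i) → S n c = S n c'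
  card_succ_of_mem : ∀ n ≥ n₀, ∀ c, IsAdmissible k c (n + 1) →
    (genealogy k c n).child (verts k n) (c n) ∈ S n c → (S (n + 1) c).card = (S n c).card + 1
  card_succ_of_notMem : ∀ n ≥ n₀, ∀ c, IsAdmissible k c (n + 1) →
    (genealogy k c n).child (verts k n) (c n) ∉ S n c → (S (n + 1) c).card = (S n c).card

theorem IsAdmissible.mono {k m n : ℕ} {c : ℕ → Sym2 TreeVertex} (hc : IsAdmissible k c n)
    (h : m ≤ n) : IsAdmissible k c m := fun i hi => hc i (hi.trans_le h)

theorem child_mem_verts {k n : ℕ} {c : ℕ → Sym2 TreeVertex} (hc : IsAdmissible k c (n + 1)) :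
    (genealogy k c n).child (verts k n) (c n) ∈ verts k n := by
  have h := describes_genealogy (hc.mono n.le_succ)
  have he := hc n n.lt_succ_self
  rw [h.edgeSet_eq] at he
  obtain ⟨v, hv, he⟩ := he
  rw [← he, h.child_edge hv]
  exact hv

/-- A family of sets that evolve by insertion of the new vertex is a splitting family. -/
theorem IsSplittingFamily.of_mem_succ {k n₀ : ℕ}
    {S : ℕ → (ℕ → Sym2 TreeVertex) → Finset TreeVertex} (hsub : ∀ n c, S n c ⊆ verts k n)
    (hcongr : ∀ n c c', (∀ i < n, c i = c' i) → S n c = S n c')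
    (hS : ∀ n ≥ n₀, ∀ c, IsAdmissible k c (n + 1) → ∀ w, w ∈ S (n + 1) c ↔
      (w = node n ∧ (genealogy k c n).child (verts k n) (c n) ∈ S n c) ∨ w ∈ S n c) :
    IsSplittingFamily k n₀ S := by
  classical
  refine ⟨hsub, hcongr, fun n hn c hc h => ?_, fun n hn c hc h => ?_⟩
  · rw [← Finset.card_insert_of_notMem (fun h1 => node_notMem_verts (hsub n c h1))]
    congr 1
    ext w
    rw [hS n hn c hc w, Finset.mem_insert]
    tauto
  · congr 1
    ext w
    rw [hS n hn c hc w]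
    tauto

theorem leaf_mem_verts_of_le {k i n : ℕ} (hk : 2 ≤ k) (h : i ≤ n) : leaf i ∈ verts k n := by
  rw [leaf_mem_verts]
  have : 1 * n ≤ (k - 1) * n := Nat.mul_le_mul_right n (by omega)
  omega

theorem isSplittingFamily_stickAbove {k : ℕ} (hk : 2 ≤ k) (i q : ℕ) :
    IsSplittingFamily k i
      (fun n c => (genealogy k c n).stickAbove (verts k n) (leaf i) q) := by
  refine .of_mem_succ (fun n c => by classical exact Finset.filter_subset _ _)
    (fun n c c' h => by rw [genealogy_congr h]) fun n hn c hc w => ?_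
  exact (describes_genealogy (hc.mono n.le_succ)).mem_stickAbove_graft (child_mem_verts hc)
    (leaf_mem_verts_of_le hk hn) q w

theorem isSplittingFamily_stickBeyond {k : ℕ} (hk : 2 ≤ k) (i q : ℕ) :
    IsSplittingFamily k (max i q)
      (fun n c => (genealogy k c n).stickBeyond (verts k n) (leaf i) q) := by
  refine .of_mem_succ (fun n c => by classical exact Finset.filter_subset _ _)
    (fun n c c' h => by rw [genealogy_congr h]) fun n hn c hc w => ?_
  exact (describes_genealogy (hc.mono n.le_succ)).mem_stickBeyond_graft (child_mem_verts hc)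
    (leaf_mem_verts_of_le hk ((le_max_left _ _).trans hn))
    (leaf_mem_verts_of_le hk ((le_max_right _ _).trans hn)) w

/-- The `i`-th stick is attached to a stick that does not depend on the time, at the node that was
created together with the `i`-th leaf. -/
theorem exists_attachment {k : ℕ} (hk : 2 ≤ k) {c : ℕ → Sym2 TreeVertex}
    (hc : ∀ n, IsAdmissible k c n) {i : ℕ} (hi : 1 ≤ i) :
    ∃ j < i, ∀ n, leaf i ∈ verts k n → ∃ u ∈ verts k n, (genealogy k c n).owner u = j ∧
      ∀ w, w ∈ (genealogy k c n).anc u ↔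
        w ∈ (genealogy k c n).anc (leaf i) ∧ (genealogy k c n).owner w ≠ i := by
  classical
  obtain ⟨n, hn, hmin⟩ := Nat.findX (p := fun n => leaf i ∈ verts k n)
    ⟨i, leaf_mem_verts_of_le hk le_rfl⟩
  obtain _ | m := n
  · rw [leaf_mem_verts] at hn; omega
  have hnew : leaf i ∈ newLeaves k m := by
    rcases mem_verts_succ.1 hn with h1 | h1 | h1
    · cases h1
    · exact h1
    · exact absurd h1 (hmin m m.lt_succ_self)
  have hd := describes_genealogy (hc m)
  have hv := child_mem_verts (hc (m + 1))
  set v := (genealogy k c m).child (verts k m) (c m) with hvdef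
  have hlt : (genealogy k c m).owner v < i := by
    have h1 := leaf_mem_verts.1 (hd.leaf_owner_mem v hv)
    obtain ⟨j, hj, hji⟩ := mem_newLeaves.1 hnew
    rw [leaf.injEq] at hji
    omega
  refine ⟨_, hlt, ?_⟩
  have key : ∀ n, m + 1 ≤ n → (genealogy k c n).owner (node m) = (genealogy k c m).owner v ∧
      ∀ w, w ∈ (genealogy k c n).anc (node m) ↔
        w ∈ (genealogy k c n).anc (leaf i) ∧ (genealogy k c n).owner w ≠ i := by
    intro n hn
    induction n, hn using Nat.le_induction with
    | base =>
      rw [genealogy, ← hvdef]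
      refine ⟨Genealogy.graft_owner_node, fun w => ?_⟩
      rw [Genealogy.graft_anc_node, Genealogy.graft_anc_newLeaf hnew]
      have hold : w ∈ (genealogy k c m).anc ((genealogy k c m).par v) →
          (Genealogy.graft k m (genealogy k c m) v).owner w ≠ i := by
        intro hw
        have hwV := hd.anc_subset (hd.par_mem v hv) hw
        rw [Genealogy.graft_owner_of_ne (by rintro rfl; exact node_notMem_verts hwV)]
        have := hd.owner_le v hv w ((hd.mem_anc_iff v hv w).2 (Or.inr hw))
        omega
      constructor
      · rintro (rfl | hw)
        · exact ⟨Or.inr (Or.inl rfl), by rw [Genealogy.graft_owner_node]; exact hlt.ne⟩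
        · exact ⟨Or.inr (Or.inr hw), hold hw⟩
      · rintro ⟨rfl | h1, h2⟩
        · rw [Genealogy.graft_owner_of_ne (by simp), hd.owner_leaf] at h2
          exact absurd rfl h2
        · exact h1
    | succ n hn ih =>
      have hd := describes_genealogy (hc n)
      have hv := child_mem_verts (hc (n + 1))
      rw [genealogy]
      set v' := (genealogy k c n).child (verts k n) (c n)
      have hmV : node m ∈ verts k n := node_mem_verts.2 hn
      have hiV : leaf i ∈ verts k n := by
        rw [leaf_mem_verts] at *
        have := Nat.mul_le_mul_left (k - 1) hn
        omega
      refine ⟨?_, fun w => ?_⟩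
      · rw [Genealogy.graft_owner_of_ne (by rw [Ne, node.injEq]; omega), ih.1]
      · rw [Genealogy.graft_anc_old (Or.inl hmV), Genealogy.graft_anc_old (Or.inl hiV)]
        by_cases hw : w = node n
        · subst hw
          have h1 : node n ∉ (genealogy k c n).anc (node m) := fun h1 =>
            node_notMem_verts (hd.anc_subset (Or.inl hmV) h1)
          have h2 : node n ∉ (genealogy k c n).anc (leaf i) := fun h1 =>
            node_notMem_verts (hd.anc_subset (Or.inl hiV) h1)
          have h3 := ih.2 v'
          rw [Genealogy.graft_owner_node]
          tauto
        · have h3 := ih.2 w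
          rw [Genealogy.graft_owner_of_ne hw]
          tauto
  intro n hn
  have hmn : m + 1 ≤ n := by
    by_contra hcon
    exact hmin n (by omega) hn
  exact ⟨node m, node_mem_verts.2 hmn, key n hmn⟩

/-- The beginning of the `i`-th stick of `T_n`, folded into `ℓ¹`. -/
noncomputable def discreteStart (k : ℕ) (c : ℕ → Sym2 TreeVertex) (n i : ℕ) : EllOne :=
  (genealogy k c n).stickStart (verts k n) (tree k c n) i

/-- The end of the `i`-th stick of `T_n`, folded into `ℓ¹`. -/
noncomputable def discreteEnd (k : ℕ) (c : ℕ → Sym2 TreeVertex) (n i : ℕ) : EllOne :=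
  (genealogy k c n).stickEnd (verts k n) (tree k c n) i

theorem exists_discreteStart_mem_segment {k : ℕ} (hk : 2 ≤ k) {c : ℕ → Sym2 TreeVertex}
    (hc : ∀ n, IsAdmissible k c n) {i : ℕ} (hi : 1 ≤ i) :
    ∃ j < i, ∀ n, leaf i ∈ verts k n →
      discreteStart k c n i ∈ segment ℝ (discreteStart k c n j) (discreteEnd k c n j) := by
  obtain ⟨j, hj, hu⟩ := exists_attachment hk hc hi
  refine ⟨j, hj, fun n hn => ?_⟩
  obtain ⟨u, huV, rfl, hanc⟩ := hu n hn
  have hd := describes_genealogy (hc n)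
  change (genealogy k c n).stickStart (verts k n) (tree k c n) i ∈ _
  rw [hd.stickStart_eq_collapse hn huV hanc]
  exact hd.mem_segment_of_owner huV

theorem isStickBreakingUpTo_discrete {k : ℕ} (hk : 2 ≤ k) {c : ℕ → Sym2 TreeVertex}
    (hc : ∀ n, IsAdmissible k c n) (n : ℕ) :
    IsStickBreakingUpTo ((k - 1) * n + 1) (discreteStart k c n) (discreteEnd k c n) := by
  have hd := describes_genealogy (hc n)
  refine ⟨?_, fun i hi h1 => ?_, fun i hi => ?_⟩
  · have h0 : leaf 0 ∈ verts k n := leaf_mem_verts_of_le hk (Nat.zero_le n)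
    ext q
    rw [discreteStart, Genealogy.stickStart]
    change _ = (0 : ℝ)
    by_cases hq : q = 0
    · subst hq
      rw [add_smul_unitVec_apply_self, hd.stickEnd_apply h0, add_neg_cancel]
    · rw [add_smul_unitVec_apply_ne _ _ hq, hd.stickEnd_apply h0, Nat.cast_eq_zero,
        Finset.card_eq_zero, Finset.eq_empty_iff_forall_notMem]
      intro w hw
      obtain ⟨-, hw', rfl⟩ := Genealogy.mem_stickAbove.1 hw
      have := hd.owner_le _ h0 w hw'
      rw [hd.owner_leaf] at this
      omega
  · obtain ⟨j, hj, h⟩ := exists_discreteStart_mem_segment hk hc h1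
    exact ⟨j, hj, h n (leaf_mem_verts.2 hi)⟩
  · exact ⟨_, by exact_mod_cast hd.stickAbove_leaf_self_pos (leaf_mem_verts.2 hi),
      Genealogy.Describes.stickEnd_eq i⟩

end TreeVertex

namespace TreeVertex

/-! ### Supermartingales along uniform edge choices -/

instance : Countable TreeVertex := by
  let f : TreeVertex → Option (ℕ ⊕ ℕ) := fun
    | root => none
    | node n => some (Sum.inl n)
    | leaf n => some (Sum.inr n)
  refine Function.Injective.countable (f := f) fun a b h => ?_
  cases a <;> cases b <;> simp_all [f]

instance : Countable (Sym2 TreeVertex) := Quot.mk_surjective.countable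

instance : MeasurableSpace (Sym2 TreeVertex) := ⊤

instance : DiscreteMeasurableSpace (Sym2 TreeVertex) := ⟨fun _ => trivial⟩

/-- The extension of a finite sequence of edges by a constant. -/
def extend {n : ℕ} (a : Fin n → Sym2 TreeVertex) : ℕ → Sym2 TreeVertex :=
  fun i => if h : i < n then a ⟨i, h⟩ else s(root, root)

theorem extend_apply {n : ℕ} (a : Fin n → Sym2 TreeVertex) {i : ℕ} (h : i < n) :
    extend a i = a ⟨i, h⟩ := by
  simp [extend, h]

/-- The edge of the `n`-th tree above `v`. -/
noncomputable def edgeAbove (k : ℕ) (c : ℕ → Sym2 TreeVertex) (n : ℕ) (v : TreeVertex) :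
    Sym2 TreeVertex :=
  s((genealogy k c n).par v, v)

theorem IsAdmissible.update {k n : ℕ} {c : ℕ → Sym2 TreeVertex} (hc : IsAdmissible k c n)
    {v : TreeVertex} (hv : v ∈ verts k n) :
    IsAdmissible k (Function.update c n (edgeAbove k c n v)) (n + 1) := by
  intro i hi
  have htree : tree k (Function.update c n (edgeAbove k c n v)) i = tree k c i :=
    tree_congr fun j hj => Function.update_of_ne (by omega) _ _
  rw [htree]
  rcases Nat.lt_succ_iff_lt_or_eq.1 hi with hi | rfl
  · rw [Function.update_of_ne (by omega)]; exact hc i hi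
  · rw [Function.update_self, (describes_genealogy hc).edgeSet_eq]
    exact ⟨v, hv, rfl⟩

theorem child_update {k n : ℕ} {c : ℕ → Sym2 TreeVertex} (hc : IsAdmissible k c n)
    {v : TreeVertex} (hv : v ∈ verts k n) :
    (genealogy k (Function.update c n (edgeAbove k c n v)) n).child (verts k n)
      (Function.update c n (edgeAbove k c n v) n) = v := by
  rw [genealogy_congr (c' := c) fun j hj => Function.update_of_ne (by omega) _ _,
    Function.update_self]
  exact (describes_genealogy hc).child_edge hv

namespace IsUniformEdgeChoice

variable {k : ℕ} {Ω : Type*} [MeasurableSpace Ω] {μ : Measure Ω}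
  {ε : ℕ → Ω → Sym2 TreeVertex}

theorem measurable (hε : IsUniformEdgeChoice k μ ε) (n : ℕ) : Measurable (ε n) :=
  measurable_to_countable' fun e => hε.1 n e

theorem measurableSet_cylinder (hε : IsUniformEdgeChoice k μ ε) (n : ℕ)
    (c : ℕ → Sym2 TreeVertex) : MeasurableSet {ω | ∀ i < n, ε i ω = c i} := by
  have : {ω | ∀ i < n, ε i ω = c i} = ⋂ i ∈ Finset.range n, {ω | ε i ω = c i} := by
    ext ω; simp
  rw [this]
  exact Finset.measurableSet_biInter _ fun i _ => hε.1 i (c i)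

/-- The choices that are not admissible have probability zero. -/
theorem measure_cylinder_eq_zero (hε : IsUniformEdgeChoice k μ ε) {n : ℕ}
    {c : ℕ → Sym2 TreeVertex} (hc : ¬ IsAdmissible k c n) :
    μ {ω | ∀ i < n, ε i ω = c i} = 0 := by
  simp only [IsAdmissible, not_forall] at hc
  obtain ⟨i, hi, hci⟩ := hc
  refine measure_mono_null (t := {ω | (∀ j < i, ε j ω = c j) ∧ ε i ω = c i})
    (fun ω hω => ⟨fun j hj => hω j (hj.trans hi), hω i hi⟩) ?_
  rw [hε.2 i c (c i), if_neg hci]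

theorem ae_isAdmissible (hε : IsUniformEdgeChoice k μ ε) :
    ∀ᵐ ω ∂μ, ∀ n, IsAdmissible k (fun i => ε i ω) n := by
  rw [ae_all_iff]
  intro n
  have h : ∀ a : Fin n → Sym2 TreeVertex, ∀ᵐ ω ∂μ,
      (∀ i < n, ε i ω = extend a i) → IsAdmissible k (extend a) n := by
    intro a
    by_cases ha : IsAdmissible k (extend a) n
    · exact Eventually.of_forall fun _ _ => ha
    · refine measure_mono_null (fun ω hω => ?_) (hε.measure_cylinder_eq_zero ha)
      by_contra hcon
      exact hω fun h => absurd h hcon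
  filter_upwards [ae_all_iff.2 h] with ω hω i hi
  have h1 : ∀ j < n, ε j ω = extend (fun j : Fin n => ε j ω) j := fun j hj => by
    rw [extend_apply _ hj]
  have h2 := hω (fun j => ε j ω) h1 i hi
  rwa [← h1 i hi, tree_congr (c' := fun j => ε j ω) fun j hj => (h1 j (hj.trans hi)).symm] at h2

/-- The filtration generated by the choices, from the time `n₀` on. -/
def filtration (hε : IsUniformEdgeChoice k μ ε) (n₀ : ℕ) : Filtration ℕ ‹MeasurableSpace Ω› where
  seq n := MeasurableSpace.comap (fun ω (i : Fin (n₀ + n)) => ε i ω) inferInstance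
  mono' := by
    intro m n hmn
    rw [← measurable_iff_comap_le]
    refine @measurable_pi_lambda _ _ _ (_) _ _ fun i => ?_
    have h1 : Measurable[MeasurableSpace.comap (fun ω (i : Fin (n₀ + n)) => ε i ω) inferInstance]
        fun ω (i : Fin (n₀ + n)) => ε i ω := comap_measurable _
    exact (measurable_pi_apply (⟨i, by omega⟩ : Fin (n₀ + n))).comp h1
  le' := fun n =>
    (measurable_pi_lambda (fun ω (i : Fin (n₀ + n)) => ε i ω) fun i => hε.measurable i).comap_le

section

variable {F : ℕ → (ℕ → Sym2 TreeVertex) → ℝ} {n : ℕ}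

theorem setIntegral_cylinder (hε : IsUniformEdgeChoice k μ ε)
    (hF : ∀ c c', (∀ i < n, c i = c' i) → F n c = F n c') (c : ℕ → Sym2 TreeVertex) :
    ∫ ω in {ω | ∀ i < n, ε i ω = c i}, F n (fun i => ε i ω) ∂μ =
      μ.real {ω | ∀ i < n, ε i ω = c i} * F n c := by
  rw [setIntegral_congr_fun (g := fun _ => F n c) (hε.measurableSet_cylinder n c)
    fun ω hω => hF _ _ hω, setIntegral_const, smul_eq_mul]

/-- The conditional mean of a function of the choices up to the time `n` is its mean over the edges
of the `n`-th tree. -/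
theorem setIntegral_cylinder_succ (hε : IsUniformEdgeChoice k μ ε) (hk : 1 ≤ k)
    (hF : ∀ c c', (∀ i < n + 1, c i = c' i) → F (n + 1) c = F (n + 1) c')
    (hint : Integrable (fun ω => F (n + 1) fun i => ε i ω) μ)
    {c : ℕ → Sym2 TreeVertex} (hc : IsAdmissible k c n) :
    ∫ ω in {ω | ∀ i < n, ε i ω = c i}, F (n + 1) (fun i => ε i ω) ∂μ =
      μ.real {ω | ∀ i < n, ε i ω = c i} / (k * n + 1) *
        ∑ v ∈ verts k n, F (n + 1) (Function.update c n (edgeAbove k c n v)) := by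
  classical
  have hd := describes_genealogy hc
  set A := {ω | ∀ i < n, ε i ω = c i} with hA
  have hcyl : ∀ e, {ω | (∀ i < n, ε i ω = c i) ∧ ε n ω = e} =
      {ω | ∀ i < n + 1, ε i ω = Function.update c n e i} := by
    intro e
    ext ω
    constructor
    · rintro ⟨h1, h2⟩ i hi
      rcases Nat.lt_succ_iff_lt_or_eq.1 hi with hi | rfl
      · rw [Function.update_of_ne (by omega)]; exact h1 i hi
      · rw [Function.update_self]; exact h2
    · intro h
      refine ⟨fun i hi => ?_, ?_⟩
      · have := h i (by omega)
        rwa [Function.update_of_ne (by omega)] at this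
      · have := h n (by omega)
        rwa [Function.update_self] at this
  have hU : A = ⋃ e, {ω | (∀ i < n, ε i ω = c i) ∧ ε n ω = e} := by
    ext ω; simp [hA]
  have h1 := hasSum_integral_iUnion (μ := μ) (f := fun ω => F (n + 1) fun i => ε i ω)
    (s := fun e => {ω | (∀ i < n, ε i ω = c i) ∧ ε n ω = e})
    (fun e => by rw [hcyl]; exact hε.measurableSet_cylinder _ _)
    (fun e e' hee => Set.disjoint_left.2 fun ω h h' => hee (h.2.symm.trans h'.2))
    hint.integrableOn
  rw [← hU] at h1
  have h2 : ∀ e, ∫ ω in {ω | (∀ i < n, ε i ω = c i) ∧ ε n ω = e}, F (n + 1) (fun i => ε i ω) ∂μ =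
      (if e ∈ (tree k c n).edgeSet then μ.real A / (k * n + 1) else 0) *
        F (n + 1) (Function.update c n e) := by
    intro e
    rw [hcyl, hε.setIntegral_cylinder hF, ← hcyl, measureReal_def, hε.2 n c e, hd.ncard_edgeSet,
      card_verts hk]
    split_ifs with h
    · rw [ENNReal.toReal_div, measureReal_def]
      norm_cast
    · simp
  have h3 : HasSum (fun e => ∫ ω in {ω | (∀ i < n, ε i ω = c i) ∧ ε n ω = e},
      F (n + 1) (fun i => ε i ω) ∂μ) (∑ e ∈ (verts k n).image (edgeAbove k c n),
        ∫ ω in {ω | (∀ i < n, ε i ω = c i) ∧ ε n ω = e}, F (n + 1) (fun i => ε i ω) ∂μ) := by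
    refine hasSum_sum_of_ne_finset_zero fun e he => ?_
    rw [h2, if_neg, zero_mul]
    rw [hd.edgeSet_eq]
    rintro ⟨v, hv, rfl⟩
    exact he (Finset.mem_image_of_mem _ hv)
  have hinj : InjOn (edgeAbove k c n) (verts k n : Set TreeVertex) := hd.edge_injOn
  rw [h1.unique h3, Finset.sum_image hinj, Finset.mul_sum]
  refine Finset.sum_congr rfl fun v hv => ?_
  rw [h2, if_pos]
  rw [hd.edgeSet_eq]
  exact ⟨v, hv, rfl⟩

/-- A nonnegative function of the past choices whose mean over the next choice does not increase
converges almost surely. -/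
theorem ae_exists_tendsto [IsProbabilityMeasure μ] (hε : IsUniformEdgeChoice k μ ε) (hk : 1 ≤ k) (n₀ : ℕ)
    (hF : ∀ n c c', (∀ i < n, c i = c' i) → F n c = F n c') (h0 : ∀ n c, 0 ≤ F n c)
    (hbdd : ∀ n, ∃ K, ∀ c, F n c ≤ K)
    (hstep : ∀ n ≥ n₀, ∀ c, IsAdmissible k c n →
      ∑ v ∈ verts k n, F (n + 1) (Function.update c n (edgeAbove k c n v)) ≤ (k * n + 1) * F n c) :
    ∀ᵐ ω ∂μ, ∃ x, Tendsto (fun n => F n fun i => ε i ω) atTop (𝓝 x) := by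
  set X : ℕ → Ω → ℝ := fun n ω => F (n₀ + n) fun i => ε i ω with hX
  have hfac : ∀ n, X n = (fun a => F (n₀ + n) (extend a)) ∘ fun ω (i : Fin (n₀ + n)) => ε i ω := by
    intro n
    ext ω
    exact hF _ _ _ fun i hi => (extend_apply (fun i : Fin (n₀ + n) => ε i ω) hi).symm
  have hadp : StronglyAdapted (hε.filtration n₀) X := by
    intro n
    refine Measurable.stronglyMeasurable ?_
    rw [hfac n]
    exact (measurable_of_countable _).comp (comap_measurable _)
  have hint : ∀ n, Integrable (X n) μ := by
    intro n
    obtain ⟨K, hK⟩ := hbdd (n₀ + n)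
    refine Integrable.of_bound ((hadp n).mono ((hε.filtration n₀).le n)).aestronglyMeasurable K
      (Eventually.of_forall fun ω => ?_)
    rw [Real.norm_eq_abs, abs_of_nonneg (h0 _ _)]
    exact hK _
  have hsuper : Supermartingale X (hε.filtration n₀) μ := by
    refine supermartingale_of_setIntegral_succ_le hadp hint fun n s hs => ?_
    obtain ⟨B, -, rfl⟩ := hs
    have hU : (fun ω (i : Fin (n₀ + n)) => ε i ω) ⁻¹' B =
        ⋃ a : B, {ω | ∀ i < n₀ + n, ε i ω = extend a.1 i} := by
      ext ω
      simp only [mem_preimage, mem_iUnion, mem_ofPred_eq]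
      constructor
      · intro h
        exact ⟨⟨_, h⟩, fun i hi => (extend_apply (fun i : Fin (n₀ + n) => ε i ω) hi).symm⟩
      · rintro ⟨⟨a, ha⟩, h⟩
        convert ha using 1
        ext i : 1
        rw [h i i.2, extend_apply _ i.2]
    have hsum : ∀ m, HasSum (fun a : B => ∫ ω in {ω | ∀ i < n₀ + n, ε i ω = extend a.1 i}, X m ω ∂μ)
        (∫ ω in (fun ω (i : Fin (n₀ + n)) => ε i ω) ⁻¹' B, X m ω ∂μ) := by
      intro m
      rw [hU]
      refine hasSum_integral_iUnion (fun a => hε.measurableSet_cylinder _ _) ?_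
        (hint m).integrableOn
      intro a b hab
      refine Set.disjoint_left.2 fun ω h h' => hab (Subtype.ext (funext fun i => ?_))
      rw [← extend_apply a.1 i.2, ← extend_apply b.1 i.2, ← h i i.2, ← h' i i.2]
    refine hasSum_le (fun a => ?_) (hsum (n + 1)) (hsum n)
    by_cases ha : IsAdmissible k (extend a.1) (n₀ + n)
    · have e1 := hε.setIntegral_cylinder_succ (F := F) (n := n₀ + n) hk (hF _) (hint (n + 1)) ha
      have e2 := hε.setIntegral_cylinder (F := F) (n := n₀ + n) (hF _) (extend a.1)
      have h3 := hstep (n₀ + n) (Nat.le_add_right _ _) _ ha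
      have hpos : (0 : ℝ) < k * (n₀ + n : ℕ) + 1 := by positivity
      refine e1.le.trans (le_trans ?_ e2.ge)
      rw [div_mul_eq_mul_div, div_le_iff₀ hpos, mul_assoc, mul_comm (F (n₀ + n) _)]
      exact mul_le_mul_of_nonneg_left h3 measureReal_nonneg
    · have hz := hε.measure_cylinder_eq_zero ha
      rw [setIntegral_measure_zero _ hz, setIntegral_measure_zero _ hz]
  have hlim := hsuper.neg.exists_ae_tendsto_of_bdd (R := (∫ ω, X 0 ω ∂μ).toNNReal) (fun n => by
    have hn : Integrable ((-X) n) μ := (hint n).neg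
    rw [eLpNorm_one_eq_lintegral_enorm, ← ofReal_integral_norm_eq_lintegral_enorm hn]
    refine ENNReal.ofReal_le_ofReal ?_
    have h1 : ∫ ω, ‖(-X) n ω‖ ∂μ = ∫ ω, X n ω ∂μ := by
      refine integral_congr_ae (Eventually.of_forall fun ω => ?_)
      simp only [Pi.neg_apply, norm_neg, Real.norm_eq_abs]
      exact abs_of_nonneg (h0 _ _)
    rw [h1, ← setIntegral_univ, ← setIntegral_univ (f := X 0)]
    exact hsuper.setIntegral_le (Nat.zero_le n) MeasurableSet.univ)
  filter_upwards [hlim] with ω ⟨x, hx⟩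
  refine ⟨-x, ?_⟩
  have := hx.neg
  simp only [Pi.neg_apply, neg_neg] at this
  rw [← tendsto_add_atTop_iff_nat n₀]
  simpa only [hX, add_comm] using this

end

end IsUniformEdgeChoice

end TreeVertex

namespace TreeVertex

/-! ### Growth of splitting families -/

/-- The expected growth of a part of the tree up to the time `n`. -/
noncomputable def growth (k n : ℕ) : ℝ := ∏ i ∈ Finset.range n, (1 + 1 / ((k : ℝ) * i + 1))

/-- The decay rate of the inverse square root of the size of a part of the tree. -/
noncomputable def decay (k n : ℕ) : ℝ := ∏ i ∈ Finset.range n, (1 - 1 / (2 * ((k : ℝ) * i + 1)))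

theorem growth_pos (k n : ℕ) : 0 < growth k n :=
  Finset.prod_pos fun i _ => by positivity

theorem one_sub_pos (k i : ℕ) : 0 < 1 - 1 / (2 * ((k : ℝ) * i + 1)) := by
  have h : (1 : ℝ) < 2 * ((k : ℝ) * i + 1) := by
    have : (0 : ℝ) ≤ (k : ℝ) * i := by positivity
    linarith
  have := (div_lt_one (by linarith)).2 h
  linarith

theorem decay_pos (k n : ℕ) : 0 < decay k n :=
  Finset.prod_pos fun i _ => one_sub_pos k i

theorem decay_sq_mul_growth_le (k n : ℕ) : decay k n ^ 2 * growth k n ≤ 1 := by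
  rw [decay, growth, ← Finset.prod_pow, ← Finset.prod_mul_distrib]
  refine Finset.prod_le_one (fun i _ => by positivity) fun i _ => ?_
  set x : ℝ := 1 / ((k : ℝ) * i + 1) with hx
  have h0 : 0 ≤ x := by positivity
  have h1 : x ≤ 1 := by
    rw [hx, div_le_one (by positivity)]
    have : (0 : ℝ) ≤ (k : ℝ) * i := by positivity
    linarith
  have h2 : 1 / (2 * ((k : ℝ) * i + 1)) = x / 2 := by rw [hx]; field_simp
  rw [h2]
  nlinarith [mul_nonneg h0 h0, mul_nonneg (mul_nonneg h0 h0) (sub_nonneg.2 h1)]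

/-- The growth is of order `n ^ (1 / k)`, by Euler's limit formula for the Gamma function. -/
theorem exists_tendsto_growth {k : ℕ} (hk : 1 ≤ k) :
    ∃ C : ℝ, 0 < C ∧ Tendsto (fun n : ℕ => (n : ℝ) ^ (-(1 / (k : ℝ))) * growth k n) atTop (𝓝 C) := by
  have hk0 : (0 : ℝ) < k := by exact_mod_cast hk
  have h1 := Real.GammaSeq_tendsto_Gamma (1 / k)
  have h2 := Real.GammaSeq_tendsto_Gamma (2 / k)
  have p1 : 0 < Real.Gamma (1 / k) := Real.Gamma_pos_of_pos (by positivity)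
  have p2 : 0 < Real.Gamma (2 / k) := Real.Gamma_pos_of_pos (by positivity)
  refine ⟨Real.Gamma (1 / k) / Real.Gamma (2 / k), div_pos p1 p2, ?_⟩
  have h3 := h1.div h2 p2.ne'
  have h4 : Tendsto (fun n : ℕ => (1 + 1 / ((k : ℝ) * n + 1))⁻¹) atTop (𝓝 1) := by
    have h5 : Tendsto (fun n : ℕ => (k : ℝ) * n + 1) atTop atTop :=
      tendsto_atTop_add_const_right _ _ (tendsto_natCast_atTop_atTop.const_mul_atTop hk0)
    have h6 := (h5.inv_tendsto_atTop.const_add (1 : ℝ)).inv₀ (by simp)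
    simpa [one_div] using h6
  have h5 := h3.mul h4
  rw [mul_one] at h5
  refine h5.congr' ?_
  filter_upwards [eventually_ge_atTop 1] with n hn
  have hn0 : (0 : ℝ) < n := by exact_mod_cast hn
  have hgs : growth k (n + 1) = (∏ j ∈ Finset.range (n + 1), (2 / (k : ℝ) + j)) /
      ∏ j ∈ Finset.range (n + 1), (1 / (k : ℝ) + j) := by
    rw [growth, ← Finset.prod_div_distrib]
    refine Finset.prod_congr rfl fun j _ => ?_
    have : (k : ℝ) * j + 1 ≠ 0 := by positivity
    have : 1 / (k : ℝ) + j ≠ 0 := by positivity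
    field_simp
    ring
  have hsucc : growth k (n + 1) = growth k n * (1 + 1 / ((k : ℝ) * n + 1)) :=
    Finset.prod_range_succ _ _
  have hne : (1 + 1 / ((k : ℝ) * n + 1)) ≠ 0 := by positivity
  have hg : growth k n = growth k (n + 1) * (1 + 1 / ((k : ℝ) * n + 1))⁻¹ := by
    rw [hsucc, mul_assoc, mul_inv_cancel₀ hne, mul_one]
  rw [hg, ← mul_assoc]
  congr 1
  rw [hgs, Pi.div_apply, Real.GammaSeq, Real.GammaSeq]
  have q1 : (∏ j ∈ Finset.range (n + 1), (1 / (k : ℝ) + j)) ≠ 0 :=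
    (Finset.prod_pos fun j _ => by positivity).ne'
  have q2 : (∏ j ∈ Finset.range (n + 1), (2 / (k : ℝ) + j)) ≠ 0 :=
    (Finset.prod_pos fun j _ => by positivity).ne'
  have q3 : ((n.factorial : ℕ) : ℝ) ≠ 0 := by exact_mod_cast n.factorial_ne_zero
  have q4 : (n : ℝ) ^ (2 / (k : ℝ)) = (n : ℝ) ^ (1 / (k : ℝ)) * (n : ℝ) ^ (1 / (k : ℝ)) := by
    rw [← Real.rpow_add hn0]; congr 1; ring
  have q5 : (n : ℝ) ^ (1 / (k : ℝ)) ≠ 0 := (Real.rpow_pos_of_pos hn0 _).ne'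
  rw [q4, Real.rpow_neg hn0.le]
  field_simp

/-- The inverse square root, shifted so that `mul_invSqrt_succ_le` holds. -/
noncomputable def invSqrt (l : ℕ) : ℝ := (√((l : ℝ) - 3 / 4))⁻¹

theorem mul_invSqrt_succ_le (l : ℕ) : l * invSqrt (l + 1) ≤ (l - 1 / 2) * invSqrt l := by
  rcases Nat.eq_zero_or_pos l with rfl | hl
  · -- the square root of a negative number is zero
    have : invSqrt 0 = 0 := by
      rw [invSqrt, Real.sqrt_eq_zero_of_nonpos (by norm_num), inv_zero]
    rw [this]; simp
  · have h1 : (1 : ℝ) ≤ l := by exact_mod_cast hl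
    have p1 : 0 < √((l : ℝ) - 3 / 4) := Real.sqrt_pos.2 (by linarith)
    have p2 : 0 < √(((l + 1 : ℕ) : ℝ) - 3 / 4) := Real.sqrt_pos.2 (by push_cast; linarith)
    rw [invSqrt, invSqrt, ← div_eq_mul_inv, ← div_eq_mul_inv, div_le_div_iff₀ p2 p1]
    refine abs_le_of_sq_le_sq' ?_ (mul_nonneg (by linarith) (Real.sqrt_nonneg _)) |>.2
    rw [mul_pow, mul_pow, Real.sq_sqrt (by linarith), Real.sq_sqrt (by push_cast; linarith)]
    push_cast
    nlinarith

namespace IsSplittingFamily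

variable {k n₀ : ℕ} {S : ℕ → (ℕ → Sym2 TreeVertex) → Finset TreeVertex}

theorem card_le (hS : IsSplittingFamily k n₀ S) (hk : 1 ≤ k) (n : ℕ) (c : ℕ → Sym2 TreeVertex) :
    (S n c).card ≤ k * n + 1 :=
  (Finset.card_le_card (hS.subset n c)).trans (card_verts hk n).le

/-- A function of the cardinality of a splitting family converges almost surely, if it is a
supermartingale for the Markov chain that goes from `l` to `l + 1` with probability
`l / (k n + 1)`. -/
theorem ae_exists_tendsto (hS : IsSplittingFamily k n₀ S) {Ω : Type*} [MeasurableSpace Ω]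
    {μ : Measure Ω} [IsProbabilityMeasure μ] {ε : ℕ → Ω → Sym2 TreeVertex}
    (hε : IsUniformEdgeChoice k μ ε) (hk : 1 ≤ k) {f : ℕ → ℕ → ℝ} (hf : ∀ n l, 0 ≤ f n l)
    (hstep : ∀ n l, l ≤ k * n + 1 →
      l * f (n + 1) (l + 1) + (k * n + 1 - l) * f (n + 1) l ≤ (k * n + 1) * f n l) :
    ∀ᵐ ω ∂μ, ∃ x, Tendsto (fun n => f n (S n fun i => ε i ω).card) atTop (𝓝 x) := by
  classical
  refine hε.ae_exists_tendsto (F := fun n c => f n (S n c).card) hk n₀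
    (fun n c c' h => by rw [hS.congr n c c' h]) (fun n c => hf n _)
    (fun n => ⟨∑ l ∈ Finset.range (k * n + 2), f n l, fun c => ?_⟩) fun n hn c hc => ?_
  · exact Finset.single_le_sum (f := f n) (fun l _ => hf n l)
      (Finset.mem_range.2 (by have := hS.card_le hk n c; omega))
  · have hcongr : ∀ v, S n (Function.update c n (edgeAbove k c n v)) = S n c := fun v =>
      hS.congr n _ _ fun i hi => Function.update_of_ne (by omega) _ _
    have hsum : ∀ v ∈ verts k n,
        f (n + 1) (S (n + 1) (Function.update c n (edgeAbove k c n v))).card =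
          if v ∈ S n c then f (n + 1) ((S n c).card + 1) else f (n + 1) (S n c).card := by
      intro v hv
      have h1 := hS.card_succ_of_mem n hn _ (hc.update hv)
      have h2 := hS.card_succ_of_notMem n hn _ (hc.update hv)
      rw [child_update hc hv, hcongr] at h1 h2
      split_ifs with h
      · rw [h1 h]
      · rw [h2 h]
    refine (Finset.sum_congr rfl hsum).le.trans ?_
    rw [Finset.sum_ite, Finset.sum_const, Finset.sum_const, nsmul_eq_mul, nsmul_eq_mul]
    have e1 : (verts k n).filter (fun v => v ∈ S n c) = S n c := by
      ext v
      rw [Finset.mem_filter]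
      exact ⟨fun h => h.2, fun h => ⟨hS.subset n c h, h⟩⟩
    have e2 : (((verts k n).filter (fun v => v ∉ S n c)).card : ℝ) =
        k * n + 1 - (S n c).card := by
      have h1 := Finset.card_filter_add_card_filter_not (s := verts k n) (fun v => v ∈ S n c)
      rw [e1, card_verts hk] at h1
      have h2 : ((S n c).card : ℝ) + ((verts k n).filter (fun v => v ∉ S n c)).card =
        k * n + 1 := by exact_mod_cast h1
      linarith
    rw [e1, e2]
    exact hstep n _ (hS.card_le hk n c)

/-- The size of a splitting family that is not empty is asymptotically equivalent to a positive
multiple of `n ^ (1 / k)`. The limit exists since the ratio of the size and of its mean growth is a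
martingale, and it is positive since the inverse square root of this ratio is dominated by a
convergent supermartingale. -/
theorem exists_tendsto (hS : IsSplittingFamily k n₀ S) {Ω : Type*} [MeasurableSpace Ω]
    {μ : Measure Ω} [IsProbabilityMeasure μ] {ε : ℕ → Ω → Sym2 TreeVertex}
    (hε : IsUniformEdgeChoice k μ ε) (hk : 1 ≤ k) :
    ∃ X : Ω → ℝ, Measurable X ∧ ∀ᵐ ω ∂μ,
      Tendsto (fun n : ℕ => (n : ℝ) ^ (-(1 / (k : ℝ))) * (S n fun i => ε i ω).card) atTop
        (𝓝 (X ω)) ∧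
      ((∀ n ≥ n₀, 0 < (S n fun i => ε i ω).card) → 0 < X ω) := by
  obtain ⟨C, hC, hgrowth⟩ := exists_tendsto_growth hk
  have h1 := hS.ae_exists_tendsto hε hk (f := fun n l => l / growth k n)
    (fun n l => div_nonneg (Nat.cast_nonneg _) (growth_pos k n).le) (fun n l hl => le_of_eq (by
      have hsucc : growth k (n + 1) = growth k n * (1 + 1 / ((k : ℝ) * n + 1)) :=
        Finset.prod_range_succ _ _
      have := (growth_pos k n).ne'
      have h0 : (k : ℝ) * n + 1 ≠ 0 := by positivity
      have h00 : (k : ℝ) * n + 1 + 1 ≠ 0 := by positivity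
      rw [hsucc]
      push_cast
      field_simp
      ring))
  have h2 := hS.ae_exists_tendsto hε hk (f := fun n l => invSqrt l / decay k n)
    (fun n l => div_nonneg (inv_nonneg.2 (Real.sqrt_nonneg _)) (decay_pos k n).le)
    (fun n l hl => by
      have hsucc : decay k (n + 1) = decay k n * (1 - 1 / (2 * ((k : ℝ) * n + 1))) :=
        Finset.prod_range_succ _ _
      have hd := decay_pos k n
      have hd' := decay_pos k (n + 1)
      have h0 : (0 : ℝ) < (k : ℝ) * n + 1 := by positivity
      have hm := mul_invSqrt_succ_le l
      have e1 : (k * n + 1) * (invSqrt l / decay k n) =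
          ((k * n + 1 - 1 / 2) * invSqrt l) / decay k (n + 1) := by
        have h3 : (k * n + 1 - 1 / 2 : ℝ) = (k * n + 1) * (1 - 1 / (2 * ((k : ℝ) * n + 1))) := by
          field_simp
        rw [hsucc, h3, mul_right_comm, mul_div_mul_right _ _ (one_sub_pos k n).ne', mul_div_assoc]
      rw [e1, mul_div_assoc', mul_div_assoc', ← add_div]
      refine div_le_div_of_nonneg_right ?_ hd'.le
      linarith)
  have hconv : ∀ᵐ ω ∂μ, ∃ x, Tendsto
      (fun n : ℕ => (n : ℝ) ^ (-(1 / (k : ℝ))) * (S n fun i => ε i ω).card) atTop (𝓝 x) := by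
    filter_upwards [h1] with ω ⟨x, hx⟩
    refine ⟨C * x, (hgrowth.mul hx).congr fun n => ?_⟩
    rw [mul_assoc, mul_div_cancel₀ _ (growth_pos k n).ne']
  obtain ⟨X, hX, hlim⟩ := measurable_limit_of_tendsto_metrizable_ae (fun n => by
    refine (Measurable.const_mul ?_ _).aemeasurable
    have : (fun ω => ((S n fun i => ε i ω).card : ℝ)) =
        (fun a : Fin n → Sym2 TreeVertex => ((S n (extend a)).card : ℝ)) ∘
          fun ω (i : Fin n) => ε i ω := by
      ext ω
      rw [Function.comp_apply, hS.congr n (extend fun i : Fin n => ε i ω) (fun i => ε i ω)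
        fun i hi => extend_apply _ hi]
    rw [this]
    exact (measurable_of_countable _).comp (measurable_pi_lambda _ fun i => hε.measurable i)) hconv
  refine ⟨X, hX, ?_⟩
  filter_upwards [hlim, h1, h2] with ω hω ⟨x, hx⟩ ⟨y, hy⟩
  refine ⟨hω, fun hpos => ?_⟩
  have hXx : X ω = C * x := by
    refine tendsto_nhds_unique hω ((hgrowth.mul hx).congr fun n => ?_)
    rw [mul_assoc, mul_div_cancel₀ _ (growth_pos k n).ne']
  rw [hXx]
  refine mul_pos hC ?_
  -- `1 ≤ K ^ 2 * (l / growth)` as soon as `K` bounds the supermartingale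
  obtain ⟨K, hK⟩ := hy.bddAbove_range
  have hle : ∀ n ≥ n₀, 1 ≤ K ^ 2 * ((S n fun i => ε i ω).card / growth k n) := by
    intro n hn
    set l := (S n fun i => ε i ω).card with hl
    have hl1 : (1 : ℝ) ≤ l := by exact_mod_cast hpos n hn
    have hs : 0 < √((l : ℝ) - 3 / 4) := Real.sqrt_pos.2 (by linarith)
    have h3 : invSqrt l / decay k n ≤ K := hK ⟨n, rfl⟩
    have hd := decay_pos k n
    have hg := growth_pos k n
    have h4 : 1 ≤ K * decay k n * √((l : ℝ) - 3 / 4) := by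
      rw [div_le_iff₀ hd, invSqrt, inv_le_iff_one_le_mul₀ hs] at h3
      exact h3
    have h5 : 1 ≤ (K * decay k n * √((l : ℝ) - 3 / 4)) ^ 2 := one_le_pow₀ h4
    rw [mul_pow, mul_pow, Real.sq_sqrt (by linarith)] at h5
    have h6 := decay_sq_mul_growth_le k n
    rw [mul_div_assoc', le_div_iff₀ hg, one_mul]
    have h7 : K ^ 2 * decay k n ^ 2 * (l - 3 / 4) * growth k n =
      K ^ 2 * (decay k n ^ 2 * growth k n) * (l - 3 / 4) := by ring
    have h8 : growth k n ≤ K ^ 2 * decay k n ^ 2 * (l - 3 / 4) * growth k n :=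
      le_mul_of_one_le_left hg.le h5
    rw [h7] at h8
    have h9 : K ^ 2 * (decay k n ^ 2 * growth k n) * (l - 3 / 4) ≤ K ^ 2 * 1 * (l - 3 / 4) :=
      mul_le_mul_of_nonneg_right (mul_le_mul_of_nonneg_left h6 (sq_nonneg K)) (by linarith)
    nlinarith [sq_nonneg K]
  have hlim' := ge_of_tendsto (hx.const_mul (K ^ 2)) (eventually_atTop.2 ⟨n₀, hle⟩)
  by_contra hcon
  nlinarith [sq_nonneg K, not_lt.1 hcon]

end IsSplittingFamily

end TreeVertex

/-! ### Convergence of stick-breaking trees -/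

theorem rootedGHDist_le_hausdorffEDist {M N : Type} [MetricSpace M] [MetricSpace N] {A : Set M}
    {B : Set N} {φ : M → N} (hφ : ∀ x ∈ A, ∀ y ∈ A, dist (φ x) (φ y) = dist x y) (a : M) :
    rootedGHDist A a B (φ a) ≤ Metric.hausdorffEDist (φ '' A) B := by
  refine iInf_le_of_le N (iInf_le_of_le inferInstance (iInf_le_of_le φ (iInf_le_of_le id
    (iInf_le_of_le hφ (iInf_le_of_le (fun _ _ _ _ => rfl) ?_)))))
  rw [image_id, id, edist_self]
  exact max_le le_rfl (zero_le)

theorem hausdorffEDist_stickTree_le {H L H' L' : ℕ → EllOne} {m : ℕ} {r : ℝ}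
    (hH : ∀ i < m, dist (H i) (H' i) ≤ r) (hL : ∀ i < m, dist (L i) (L' i) ≤ r) :
    Metric.hausdorffEDist (stickTree H L m) (stickTree H' L' m) ≤ ENNReal.ofReal r := by
  have key : ∀ H L H' L' : ℕ → EllOne, (∀ i < m, dist (H i) (H' i) ≤ r) →
      (∀ i < m, dist (L i) (L' i) ≤ r) → ∀ x ∈ stickTree H L m, ∃ y ∈ stickTree H' L' m,
      edist x y ≤ ENNReal.ofReal r := by
    rintro H L H' L' hH hL _ ⟨i, hi, a, b, ha, hb, hab, rfl⟩
    refine ⟨a • H' i + b • L' i, ⟨i, hi, a, b, ha, hb, hab, rfl⟩, ?_⟩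
    rw [edist_dist]
    refine ENNReal.ofReal_le_ofReal ((dist_add_add_le _ _ _ _).trans ?_)
    rw [dist_smul₀, dist_smul₀, Real.norm_of_nonneg ha, Real.norm_of_nonneg hb]
    calc a * dist (H i) (H' i) + b * dist (L i) (L' i) ≤ a * r + b * r :=
          add_le_add (mul_le_mul_of_nonneg_left (hH i hi) ha)
            (mul_le_mul_of_nonneg_left (hL i hi) hb)
      _ = r := by rw [← add_mul, hab, one_mul]
  exact Metric.hausdorffEDist_le_of_mem_edist (key H L H' L' hH hL)
    (key H' L' H L (fun i hi => by rw [dist_comm]; exact hH i hi)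
      fun i hi => by rw [dist_comm]; exact hL i hi)

theorem smul_mem_segment_smul {E : Type*} [AddCommGroup E] [Module ℝ E] {x y z : E}
    (h : x ∈ segment ℝ y z) (c : ℝ) : c • x ∈ segment ℝ (c • y) (c • z) := by
  obtain ⟨a, b, ha, hb, hab, rfl⟩ := h
  exact ⟨a, b, ha, hb, hab, by rw [smul_add, smul_comm c a, smul_comm c b]⟩

theorem smul_stickTree (H L : ℕ → EllOne) (m : ℕ) (c : ℝ) :
    (fun x : EllOne => c • x) '' stickTree H L m =
      stickTree (fun i => c • H i) (fun i => c • L i) m := by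
  ext z
  constructor
  · rintro ⟨z, ⟨i, hi, hz⟩, rfl⟩
    exact ⟨i, hi, smul_mem_segment_smul hz c⟩
  · rintro ⟨i, hi, a, b, ha, hb, hab, rfl⟩
    refine ⟨a • H i + b • L i, ⟨i, hi, a, b, ha, hb, hab, rfl⟩, ?_⟩
    change c • (a • H i + b • L i) = a • c • H i + b • c • L i
    rw [smul_add, smul_comm c a, smul_comm c b]

theorem isClosed_setOf_mem_segment (E : Type*) [NormedAddCommGroup E] [NormedSpace ℝ E] :
    IsClosed {p : E × E × E | p.1 ∈ segment ℝ p.2.1 p.2.2} := by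
  have h : IsClosed {q : Icc (0 : ℝ) 1 × (E × E × E) |
      q.2.2.1 + (q.1 : ℝ) • (q.2.2.2 - q.2.2.1) = q.2.1} :=
    isClosed_eq (by fun_prop) (by fun_prop)
  convert isClosedMap_snd_of_compactSpace _ h using 1
  ext ⟨x, y, z⟩
  simp only [mem_ofPred_eq, segment_eq_image', mem_image, Prod.exists, Subtype.exists]
  constructor
  · rintro ⟨t, ht, h⟩
    exact ⟨t, ht, x, y, z, h, rfl⟩
  · rintro ⟨t, ht, x', y', z', h, he⟩
    cases he
    exact ⟨t, ht, h⟩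

namespace TreeVertex

theorem discreteEnd_eq_sum {k : ℕ} (hk : 2 ≤ k) {c : ℕ → Sym2 TreeVertex}
    (hc : ∀ n, IsAdmissible k c n) {i n : ℕ} (hi : i ≤ n) :
    discreteEnd k c n i = ∑ q ∈ Finset.range (i + 1),
      (((genealogy k c n).stickAbove (verts k n) (leaf i) q).card : ℝ) • unitVec q := by
  have hd := describes_genealogy (hc n)
  have hV := leaf_mem_verts_of_le hk hi
  ext q
  rw [lp.coeFn_sum, Finset.sum_apply]
  have h1 : ∀ q' ∈ Finset.range (i + 1),
      ((((genealogy k c n).stickAbove (verts k n) (leaf i) q').card : ℝ) • unitVec q' : EllOne) q =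
      if q = q' then (((genealogy k c n).stickAbove (verts k n) (leaf i) q').card : ℝ) else 0 := by
    intro q' _
    change (((genealogy k c n).stickAbove (verts k n) (leaf i) q').card : ℝ) * unitVec q' q = _
    split_ifs with h
    · rw [h, lp.single_apply_self, mul_one]
    · rw [lp.single_apply_ne _ _ _ h, mul_zero]
  rw [Finset.sum_congr rfl h1, Finset.sum_ite_eq, discreteEnd, hd.stickEnd_apply hV]
  split_ifs with h
  · rfl
  · rw [Nat.cast_eq_zero, Finset.card_eq_zero, Finset.eq_empty_iff_forall_notMem]
    intro w hw
    obtain ⟨-, hw', rfl⟩ := Genealogy.mem_stickAbove.1 hw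
    have := hd.owner_le _ hV w hw'
    rw [hd.owner_leaf] at this
    exact h (Finset.mem_range.2 (by omega))

/-- Folding shows that the rescaled marginals are close to a stick-breaking tree if the ends of
their rescaled sticks are. -/
theorem rootedGHDist_marginal_le {k : ℕ} (hk : 2 ≤ k) {c : ℕ → Sym2 TreeVertex}
    (hc : ∀ n, IsAdmissible k c n) {n p : ℕ} (hp : p ≤ n) (s : ℝ) {H L : ℕ → EllOne} {r : ℝ}
    (hH : ∀ i < (k - 1) * p + 1, dist (s • discreteStart k c n i) (H i) ≤ r)
    (hL : ∀ i < (k - 1) * p + 1, dist (s • discreteEnd k c n i) (L i) ≤ r) :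
    rootedGHDist (s • marginal k p (tree k c n)) 0 (stickTree H L ((k - 1) * p + 1)) 0 ≤
      ENNReal.ofReal r := by
  have hd := describes_genealogy (hc n)
  set φ := (genealogy k c n).collapse (verts k n)
  have himage : φ '' (s • marginal k p (tree k c n)) =
      stickTree (fun i => s • discreteStart k c n i) (fun i => s • discreteEnd k c n i)
        ((k - 1) * p + 1) := by
    rw [← smul_stickTree]
    change φ '' ((fun x => s • x) '' _) = (fun x => s • x) '' stickTree _ _ _
    have h1 := hd.image_marginal (p := p) (fun j => leaf_mem_verts)
      (isStickBreakingUpTo_discrete hk hc n)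
      (Nat.succ_le_succ (Nat.mul_le_mul_left _ hp))
    have h2 : stickTree (discreteStart k c n) (discreteEnd k c n) ((k - 1) * p + 1) =
      φ '' marginal k p (tree k c n) := h1.symm
    rw [h2, image_image, image_image]
    simp only [map_smul]
  have h0 : φ 0 = 0 := map_zero φ
  have h1 := rootedGHDist_le_hausdorffEDist (A := s • marginal k p (tree k c n)) (φ := φ)
    (B := stickTree H L ((k - 1) * p + 1)) (by
      rintro _ ⟨x, hx, rfl⟩ _ ⟨y, hy, rfl⟩
      change dist (φ (s • x)) (φ (s • y)) = dist (s • x) (s • y)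
      rw [map_smul, map_smul, dist_smul₀, dist_smul₀,
        hd.dist_collapse (hd.isTreePoint_of_mem_marginal hx) (hd.isTreePoint_of_mem_marginal hy)]) 0
  rw [h0, himage] at h1
  exact h1.trans (hausdorffEDist_stickTree_le hH hL)

/-- If the rescaled sizes of the parts of the sticks above the leaves converge, with positive limits
for the whole sticks, then the limits define a stick-breaking construction, and the rescaled ends of
the discrete sticks converge to the ends of its sticks. -/
theorem isStickBreaking_of_tendsto {k : ℕ} (hk : 2 ≤ k) {c : ℕ → Sym2 TreeVertex}
    (hc : ∀ n, IsAdmissible k c n) {s : ℕ → ℝ} {H L : ℕ → EllOne} {x : ℕ → ℕ → ℝ}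
    (hLx : ∀ i, L i = ∑ q ∈ Finset.range (i + 1), x i q • unitVec q)
    (hHx : ∀ i, H i = L i + (-x i i) • unitVec i)
    (hx : ∀ i q, Tendsto (fun n => s n *
      ((genealogy k c n).stickAbove (verts k n) (leaf i) q).card) atTop (𝓝 (x i q)))
    (hpos : ∀ i, 0 < x i i) :
    IsStickBreaking H L ∧ (∀ i, Tendsto (fun n => s n • discreteEnd k c n i) atTop (𝓝 (L i))) ∧
      ∀ i, Tendsto (fun n => s n • discreteStart k c n i) atTop (𝓝 (H i)) := by
  have hL : ∀ i, Tendsto (fun n => s n • discreteEnd k c n i) atTop (𝓝 (L i)) := by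
    intro i
    rw [hLx i]
    refine (tendsto_finsetSum (Finset.range (i + 1))
      fun q _ => (hx i q).smul_const (unitVec q)).congr' ?_
    filter_upwards [eventually_ge_atTop i] with n hn
    rw [discreteEnd_eq_sum hk hc hn, Finset.smul_sum]
    simp only [smul_smul]
  have hH : ∀ i, Tendsto (fun n => s n • discreteStart k c n i) atTop (𝓝 (H i)) := by
    intro i
    rw [hHx i]
    refine ((hL i).add ((hx i i).neg.smul_const (unitVec i))).congr fun n => ?_
    rw [discreteStart, discreteEnd, Genealogy.stickStart, smul_add, smul_smul, mul_neg]
  refine ⟨⟨?_, fun i hi => ?_, fun i => ⟨x i i, hpos i, ?_⟩⟩, hL, hH⟩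
  · refine tendsto_nhds_unique (hH 0) (tendsto_const_nhds.congr fun n => ?_)
    rw [(isStickBreakingUpTo_discrete hk hc n).start, smul_zero]
  · obtain ⟨j, hj, hseg⟩ := exists_discreteStart_mem_segment hk hc hi
    refine ⟨j, hj, ?_⟩
    have hlim := (hH i).prodMk_nhds ((hH j).prodMk_nhds (hL j))
    refine (isClosed_setOf_mem_segment EllOne).mem_of_tendsto hlim ?_
    filter_upwards [eventually_ge_atTop i] with n hn
    exact smul_mem_segment_smul (hseg n (leaf_mem_verts_of_le hk hn)) (s n)
  · rw [hHx i, add_assoc, ← add_smul, neg_add_cancel, zero_smul, add_zero]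

end TreeVertex

theorem mainTheorem10 (k : ℕ) (hk : 2 ≤ k) {Ω : Type*} [MeasurableSpace Ω] (μ : Measure Ω)
    [IsProbabilityMeasure μ] (ε : ℕ → Ω → Sym2 TreeVertex)
    (hε : TreeVertex.IsUniformEdgeChoice k μ ε) :
    ∃ (𝒯 : ℕ → Ω → Set EllOne) (H L : ℕ → Ω → EllOne),
      (∀ i, StronglyMeasurable (H i)) ∧ (∀ i, StronglyMeasurable (L i)) ∧
      ∀ᵐ ω ∂μ,
        -- the limits are built by one and the same stick-breaking construction
        IsStickBreaking (fun i => H i ω) (fun i => L i ω) ∧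
        (∀ p, 𝒯 p ω = stickTree (fun i => H i ω) (fun i => L i ω) ((k - 1) * p + 1)) ∧
        -- they are compact real trees, rooted at the origin, with the leaves `L 0, …, L ((k - 1) p)`
        (∀ p, IsCompact (𝒯 p ω) ∧ IsRTree (𝒯 p ω) ∧ (0 : EllOne) ∈ 𝒯 p ω ∧
          treeLeaves (𝒯 p ω) 0 = {x | ∃ i < (k - 1) * p + 1, x = L i ω} ∧
          (treeLeaves (𝒯 p ω) 0).ncard = (k - 1) * p + 1) ∧
        -- convergence of the rescaled marginals for the rooted Gromov–Hausdorff distance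
        (∀ p, Tendsto
          (fun n : ℕ => rootedGHDist
            (((n : ℝ) ^ (-(1 / (k : ℝ)))) •
              TreeVertex.marginal k p (TreeVertex.tree k (fun i => ε i ω) n)) 0
            (𝒯 p ω) 0) atTop (𝓝 0)) ∧
        -- the leaves of the limits are the limits of the leaves
        (∀ i, Tendsto
          (fun n : ℕ => (n : ℝ) ^ (-(1 / (k : ℝ))) *
            ((TreeVertex.tree k (fun i => ε i ω) n).dist .root (.leaf i) : ℝ))
          atTop (𝓝 (dist 0 (L i ω)))) ∧
        (∀ i j, Tendsto
          (fun n : ℕ => (n : ℝ) ^ (-(1 / (k : ℝ))) *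
            ((TreeVertex.tree k (fun i => ε i ω) n).dist (.leaf i) (.leaf j) : ℝ))
          atTop (𝓝 (dist (L i ω) (L j ω)))) ∧
        -- nesting
        ∀ p' p, p' < p →
          𝒯 p' ω = treeSpan (𝒯 p ω) ({0} ∪ {x | ∃ i < (k - 1) * p' + 1, x = L i ω}) := by
  have hk1 : 1 ≤ k := by omega
  choose X hXm hX using fun i q : ℕ =>
    (TreeVertex.isSplittingFamily_stickAbove hk i q).exists_tendsto hε hk1
  choose Y hYm hY using fun i q : ℕ =>
    (TreeVertex.isSplittingFamily_stickBeyond hk i q).exists_tendsto hε hk1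
  set L : ℕ → Ω → EllOne := fun i ω => ∑ q ∈ Finset.range (i + 1), X i q ω • unitVec q with hLdef
  set H : ℕ → Ω → EllOne := fun i ω => L i ω + (-X i i ω) • unitVec i with hHdef
  have hLm : ∀ i, StronglyMeasurable (L i) := fun i => by
    refine Finset.stronglyMeasurable_fun_sum _ fun q _ => ?_
    exact (hXm i q).stronglyMeasurable.smul_const _
  refine ⟨fun p ω => stickTree (fun i => H i ω) (fun i => L i ω) ((k - 1) * p + 1), H, L,
    fun i => (hLm i).add ((hXm i i).neg.stronglyMeasurable.smul_const _), hLm, ?_⟩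
  filter_upwards [hε.ae_isAdmissible, ae_all_iff.2 fun i => ae_all_iff.2 (hX i),
    ae_all_iff.2 fun i => ae_all_iff.2 (hY i)] with ω hc hX hY
  set c : ℕ → Sym2 TreeVertex := fun i => ε i ω with hcdef
  have hd := fun n => TreeVertex.describes_genealogy (hc n)
  have hXpos : ∀ i, 0 < X i i ω := fun i => (hX i i).2 fun n hn =>
    (hd n).stickAbove_leaf_self_pos (TreeVertex.leaf_mem_verts_of_le hk hn)
  have hYpos : ∀ i j, i ≠ j → 0 < Y i j ω := fun i j hij => (hY i j).2 fun n hn =>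
    (hd n).stickBeyond_leaf_pos (TreeVertex.leaf_mem_verts_of_le hk ((le_max_left _ _).trans hn))
      (TreeVertex.leaf_mem_verts_of_le hk ((le_max_right _ _).trans hn)) hij
  obtain ⟨hsb, hLlim, hHlim⟩ := TreeVertex.isStickBreaking_of_tendsto hk hc (H := fun i => H i ω)
    (L := fun i => L i ω) (x := fun i q => X i q ω) (fun i => rfl) (fun i => rfl)
    (fun i q => (hX i q).1) hXpos
  have hHL : ∀ i j, H i ω ≠ L j ω := by
    intro i j he
    have hjj : (L j ω) j = X j j ω := sum_smul_unitVec_apply _ le_rfl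
    rcases le_or_gt i j with hij | hij
    · have h1 := (hsb.upTo (i + 1)).start_apply_eq_zero i.lt_succ_self hij
      simp only [he, hjj] at h1
      exact (hXpos j).ne' h1
    · -- the part of the `j`-th stick beyond the `i`-th leaf is not negligible
      have hij' : (H i ω) j = X i j ω := by
        rw [hHdef]
        exact (add_smul_unitVec_apply_ne _ _ hij.ne).trans (sum_smul_unitVec_apply _ hij.le)
      have hsum : X i j ω + Y i j ω = X j j ω := by
        refine tendsto_nhds_unique ((hX i j).1.add (hY i j).1) ((hX j j).1.congr fun n => ?_)
        rw [← (hd n).card_stickAbove_add_card_stickBeyond (i := i)]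
        push_cast
        ring
      have := hYpos i j hij.ne'
      rw [he, hjj] at hij'
      linarith
  refine ⟨hsb, fun p => rfl, fun p => ?_, fun p => ?_, fun i => ?_, fun i j => ?_,
    fun p' p hpp => ?_⟩
  · have h := hsb.upTo ((k - 1) * p + 1)
    have hleaves := h.treeLeaves_eq fun i _ j _ => hHL i j
    exact ⟨h.isCompact, h.isRTreeSet.isRTree, h.zero_mem (Nat.succ_pos _), hleaves,
      by rw [hleaves]; exact h.ncard_leaves⟩
  · set m := (k - 1) * p + 1
    set s : ℕ → ℝ := fun n => (n : ℝ) ^ (-(1 / (k : ℝ)))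
    have hr : Tendsto (fun n => ∑ i ∈ Finset.range m, (dist (s n • TreeVertex.discreteStart k c n i) (H i ω) +
        dist (s n • TreeVertex.discreteEnd k c n i) (L i ω))) atTop (𝓝 0) := by
      rw [show (0 : ℝ) = ∑ i ∈ Finset.range m, (0 + 0) by simp]
      exact tendsto_finsetSum _ fun i _ => (tendsto_iff_dist_tendsto_zero.1 (hHlim i)).add
        (tendsto_iff_dist_tendsto_zero.1 (hLlim i))
    have hr' := ENNReal.tendsto_ofReal hr
    rw [ENNReal.ofReal_zero] at hr'
    refine tendsto_of_tendsto_of_tendsto_of_le_of_le' tendsto_const_nhds hr'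
      (Eventually.of_forall fun n => zero_le) ?_
    filter_upwards [eventually_ge_atTop p] with n hn
    have hle : ∀ i < m, dist (s n • TreeVertex.discreteStart k c n i) (H i ω) +
        dist (s n • TreeVertex.discreteEnd k c n i) (L i ω) ≤ ∑ i ∈ Finset.range m,
        (dist (s n • TreeVertex.discreteStart k c n i) (H i ω) +
          dist (s n • TreeVertex.discreteEnd k c n i) (L i ω)) := fun i hi =>
      Finset.single_le_sum (f := fun i => dist (s n • TreeVertex.discreteStart k c n i) (H i ω) +
        dist (s n • TreeVertex.discreteEnd k c n i) (L i ω)) (fun i _ => by positivity) (Finset.mem_range.2 hi)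
    exact TreeVertex.rootedGHDist_marginal_le hk hc hn (s n)
      (fun i hi => (le_add_of_nonneg_right dist_nonneg).trans (hle i hi))
      (fun i hi => (le_add_of_nonneg_left dist_nonneg).trans (hle i hi))
  · refine (tendsto_const_nhds.dist (hLlim i)).congr' ?_
    filter_upwards [eventually_ge_atTop i] with n hn
    rw [(hd n).dist_root_leaf (TreeVertex.leaf_mem_verts_of_le hk hn)]
    conv_lhs => rw [← smul_zero ((n : ℝ) ^ (-(1 / (k : ℝ))))]
    rw [dist_smul₀, Real.norm_of_nonneg (by positivity), TreeVertex.discreteEnd]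
  · refine ((hLlim i).dist (hLlim j)).congr' ?_
    filter_upwards [eventually_ge_atTop (max i j)] with n hn
    rw [(hd n).dist_leaf_leaf (TreeVertex.leaf_mem_verts_of_le hk ((le_max_left _ _).trans hn))
      (TreeVertex.leaf_mem_verts_of_le hk ((le_max_right _ _).trans hn)), dist_smul₀,
      Real.norm_of_nonneg (by positivity), TreeVertex.discreteEnd, TreeVertex.discreteEnd]
  · exact (hsb.upTo ((k - 1) * p + 1)).stickTree_eq_treeSpan (Nat.succ_pos _)
      (Nat.succ_le_succ (Nat.mul_le_mul_left _ hpp.le))
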